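/- **Language.** Let $\mathsf{A}=\{a_1,\dots,a_m\}$ ($m\in\mathbb N$, possibly $0$) be a finite set of agents, $\mathsf{Prop}$ a nonempty, at most countable set of propositional letters, and for each agent $a$ let $A_a\in\mathsf{Prop}$ be a letter ("$a$ is active"). Let $[0,1]_{\mathbb Q}=[0,1]\cap\mathbb Q$. Formulas are built from letters with $\neg,\wedge$, the temporal operators $\bigcirc$ (next), $\mathsf U$ (until), $\bullet$ (previous), $\mathsf S$ (since), the knowledge operators $K_a$, common knowledge $C$, and the probability operators $P_{\ge s}$ and $P_{a,\ge s}$ ($a\in\mathsf A$, $s\in[0,1]_{\mathbb Q}$). The connectives $\to,\vee,\leftrightarrow$ are the usual abbreviations; $E\alpha:=\bigwedge_{a}K_a\alpha$, $E^0\alpha:=\alpha$, $E^{n+1}\alpha:=EE^n\alpha$; $\Diamond\alpha:=(\alpha\to\alpha)\mathsf U\alpha$; $\blacklozenge\alpha:=(\alpha\to\alpha)\mathsf S\alpha$; $P_{<s}\alpha:=\neg P_{\ge s}\alpha$, $P_{\le s}\alpha:=P_{\ge 1-s}\neg\alpha$, and likewise for $P_{a,\cdot}$. Empty conjunctions are read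 as the tautology $\alpha\to\alpha$. For formulas $\beta_0,\dots,\beta_k$ and operators $X_1,\dots,X_k\in\{K_a:a\in\mathsf A\}\cup\{\bigcirc,\bullet\}$ let $\Phi_0(\tau)=\beta_0\to\tau$ and $\Phi_k(\tau)=\beta_k\to X_k\Phi_{k-1}(\tau)$; the formula $\Phi_k(\tau)$ is a $k$-nested implication. **Models.** A model consists of a nonempty family $R$ of runs, where each run $r$ determines a function $r:\mathbb N\to\mathcal P(\mathsf{Prop})$ (different members of the family may determine the same function), with worlds $W=R\times\mathbb N$, and of the following data. * For each world, the set of active agents: $a$ is active in $(r,n)$ iff $A_a\in r(n)$. * For each agent $a$, a symmetric and transitive relation $\mathcal K_a$ on $W$, such that $w\,\mathcal K_a\,w$ whenever $a$ is active in $w$, and such that $a$ is not active in $w$ iff $w$ has no $\mathcal K_a$-successor. * For each world $w$, an algebra $H^w$ of subsets of $R$ with a finitely additive probability $\mu^w:H^w\to[0,1]$; and for each agent $a$ a nonempty set $W_a^w\subseteq W$, an algebra $H_a^w$ of subsets of $W_a^w$, and a finitely additive probability $\mu_a^w:H_a^w\to[0,1]$. Satisfaction $(r,n)\models\alpha$ is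 defined as follows. * $p$: $p\in r(n)$; $\neg,\wedge$ as usual; $\bigcirc\beta$: $(r,n+1)\models\beta$; $\bullet\beta$: $n=0$ or $(r,n-1)\models\beta$. * $\alpha\mathsf U\beta$: for some $j\ge n$, $(r,j)\models\beta$ and $(r,k)\models\alpha$ whenever $n\le k<j$. $\alpha\mathsf S\beta$: for some $j\le n$, $(r,j)\models\beta$ and $(r,k)\models\alpha$ whenever $j<k\le n$. * $K_a\beta$: $\beta$ holds in all $\mathcal K_a$-successors of $(r,n)$; $C\beta$: $(r,n)\models E^k\beta$ for all $k\ge0$. * $P_{\ge s}\beta$: $\mu^{(r,n)}(\{r'\in R:(r',0)\models\beta\})\ge s$; $P_{a,\ge s}\beta$: $\mu_a^{(r,n)}(\{w'\in W_a^{(r,n)}:w'\models\beta\})\ge s$. A model is *measurable* if all the sets in the last item belong to the corresponding algebras, for all worlds, agents and formulas $\beta$. **Axiom system $Ax$.** The axioms are all instances of the following schemata: * classical propositional tautologies; * $\neg\bigcirc\alpha\leftrightarrow\bigcirc\neg\alpha$; $\bigcirc(\alpha\to\beta)\to(\bigcirc\alpha\to\bigcirc\beta)$; $\alpha\mathsf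 U\beta\leftrightarrow\beta\vee(\alpha\wedge\bigcirc(\alpha\mathsf U\beta))$; $\alpha\mathsf U\beta\to\Diamond\beta$; $\neg\bullet\neg\alpha\to\bullet\alpha$; $\bullet(\alpha\to\beta)\to(\bullet\alpha\to\bullet\beta)$; $(\bullet\alpha\wedge\bullet\beta)\to\bullet(\alpha\wedge\beta)$; $\bigcirc\bullet\alpha\leftrightarrow\alpha$; $\bigcirc\bullet\alpha\to\bullet\bigcirc\alpha$; $\neg\bullet(\gamma\wedge\neg\gamma)\to(\bigcirc\bullet\alpha\leftrightarrow\bullet\bigcirc\alpha)$; $\alpha\mathsf S\beta\leftrightarrow[\beta\vee(\neg\bullet(\alpha\wedge\neg\alpha)\wedge(\alpha\wedge\bullet(\alpha\mathsf S\beta)))]$; $\blacklozenge\bullet\beta$; * $K_a(\alpha\to\beta)\to(K_a\alpha\to K_a\beta)$; $A_a\to(K_a\alpha\to\alpha)$; $A_a\to K_aA_a$; $\neg A_a\to K_a(\alpha\wedge\neg\alpha)$; $\neg\alpha\to K_a\neg K_a\alpha$; $K_a\alpha\to K_aK_a\alpha$; $C\alpha\to E^k\alpha$ ($k\in\mathbb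 N$); * for $P$ being the operator on runs, and also for $P$ being the operator of any agent $a$: $P_{\ge0}\alpha$; $P_{\le r}\alpha\to P_{<t}\alpha$ ($t>r$); $P_{<t}\alpha\to P_{\le t}\alpha$; $(P_{\ge r}\alpha\wedge P_{\ge t}\beta\wedge P_{\ge1}\neg(\alpha\wedge\beta))\to P_{\ge\min(1,r+t)}(\alpha\vee\beta)$; $(P_{\le r}\alpha\wedge P_{<t}\beta)\to P_{<r+t}(\alpha\vee\beta)$ ($r+t\le1$); * for the operator on runs only: $P_{\ge1}\bullet(\alpha\wedge\neg\alpha)$. The rules are * modus ponens; * necessitation: from $\alpha$ infer $\bigcirc\alpha$, $\bullet\alpha$, $K_a\alpha$, $P_{\ge1}\alpha$, $P_{a,\ge1}\alpha$; * the infinitary rules, for all nested implications $\Phi_k$: - from $\Phi_k(\neg((\bigwedge_{l<i}\bigcirc^l\alpha)\wedge\bigcirc^i\beta))$ for all $i\in\mathbb N$ infer $\Phi_k(\neg(\alpha\mathsf U\beta))$; - from $\Phi_k(\neg((\bigwedge_{l<i}\bullet^l\alpha)\wedge(\bigwedge_{l\le i}\neg\bullet^l(\alpha\wedge\neg\alpha))\wedge\bullet^i\beta))$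 for all $i\in\mathbb N$ infer $\Phi_k(\neg(\alpha\mathsf S\beta))$; - from $\Phi_k(E^i\alpha)$ for all $i\in\mathbb N$ infer $\Phi_k(C\alpha)$; - for $r\in(0,1]\cap\mathbb Q$ and $P$ the operator on runs or of an agent: from $\Phi_k(P_{\ge r-1/i}\alpha)$ for all $i\in\mathbb N$ with $i\ge1/r$ infer $\Phi_k(P_{\ge r}\alpha)$. A proof is a sequence of formulas of at most countable successor ordinal length. A *theorem* is the last formula of a proof in which each formula is an axiom or follows from preceding formulas by a rule. A formula is *derivable* from a set $T$ of formulas if it is the last formula of a proof in which formulas of $T$ may also be used and in which the premises of necessitation rules must be theorems. $T$ is *$Ax$-consistent* if some formula is not derivable from $T$. **Theorem (strong completeness for $Ax$).** A set $T$ of formulas is $Ax$-consistent if and only if it is satisfiable, i.e. there are a measurable model and a world of it in which all formulas of $T$ hold. -/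

import Mathlib

namespace PTEL

universe u

/-- The rational numbers of the unit interval. -/
abbrev UnitQ : Type := Set.Icc (0 : ℚ) 1

/-- The number `1 - s`. -/
def UnitQ.compl (s : UnitQ) : UnitQ :=
  ⟨1 - s.1, sub_nonneg.2 s.2.2, sub_le_self 1 s.2.1⟩

/-- Index of a probability operator: probability on runs, or probability of the agent `a` on
possible worlds. -/
inductive ProbIdx (m : ℕ) : Type
  | run : ProbIdx m
  | agent (a : Fin m) : ProbIdx m

/-- Formulas over the agents `Fin m` and the given propositional letters.
`prob .run s α` is `P_{≥ s} α` and `prob (.agent a) s α` is `P_{a, ≥ s} α`. -/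
inductive Formula (m : ℕ) (Letter : Type u) : Type u
  | letter (p : Letter) : Formula m Letter
  | neg (α : Formula m Letter) : Formula m Letter
  | and (α β : Formula m Letter) : Formula m Letter
  | next (α : Formula m Letter) : Formula m Letter
  | til (α β : Formula m Letter) : Formula m Letter
  | prev (α : Formula m Letter) : Formula m Letter
  | since (α β : Formula m Letter) : Formula m Letter
  | know (a : Fin m) (α : Formula m Letter) : Formula m Letter
  | common (α : Formula m Letter) : Formula m Letter
  | prob (o : ProbIdx m) (s : UnitQ) (α : Formula m Letter) : Formula m Letter

namespace Formula

variable {m : ℕ} {Letter : Type u}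

/-- `α → β`. -/
def imp (α β : Formula m Letter) : Formula m Letter := neg (and α (neg β))

/-- `α ∨ β`. -/
def or (α β : Formula m Letter) : Formula m Letter := neg (and (neg α) (neg β))

/-- `α ↔ β`. -/
def iff (α β : Formula m Letter) : Formula m Letter := and (imp α β) (imp β α)

/-- `α ∧ ¬ α`. -/
def contra (α : Formula m Letter) : Formula m Letter := and α (neg α)

/-- The conjunction of a finite list of formulas. The empty conjunction is the given
formula `t` (a tautology in all uses below). -/
def conj (t : Formula m Letter) : List (Formula m Letter) → Formula m Letter
  | [] => t
  | [α] => α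
  | α :: β :: l => and α (conj t (β :: l))

/-- "Everybody knows `α`": the conjunction of all `K_a α`. -/
def everyone (α : Formula m Letter) : Formula m Letter :=
  conj (imp α α) ((List.finRange m).map fun a => know a α)

/-- "Sometime `α`". -/
def sometime (α : Formula m Letter) : Formula m Letter := til (imp α α) α

/-- "Once `α`". -/
def once (α : Formula m Letter) : Formula m Letter := since (imp α α) α

/-- `P_{< s} α` (on runs or for an agent). -/
def probLt (o : ProbIdx m) (s : UnitQ) (α : Formula m Letter) : Formula m Letter :=
  neg (prob o s α)

/-- `P_{≤ s} α` (on runs or for an agent). -/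
def probLe (o : ProbIdx m) (s : UnitQ) (α : Formula m Letter) : Formula m Letter :=
  prob o s.compl (neg α)

/-- The formula `(⋀_{l < i} ○^l α) ∧ ○^i β`. -/
def tilStep (α β : Formula m Letter) (i : ℕ) : Formula m Letter :=
  and (conj (imp α α) ((List.range i).map fun l => next^[l] α)) (next^[i] β)

/-- The formula `(⋀_{l < i} ●^l α) ∧ (⋀_{l ≤ i} ¬ ●^l (α ∧ ¬ α)) ∧ ●^i β`. -/
def sinceStep (α β : Formula m Letter) (i : ℕ) : Formula m Letter :=
  and
    (and (conj (imp α α) ((List.range i).map fun l => prev^[l] α))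
      (conj (imp α α) ((List.range (i + 1)).map fun l => neg (prev^[l] (contra α)))))
    (prev^[i] β)

end Formula

/-- The operators allowed in nested implications: `K_a`, `○`, `●`. -/
inductive Op (m : ℕ) : Type
  | know (a : Fin m) : Op m
  | next : Op m
  | prev : Op m

/-- Application of an operator to a formula. -/
def Op.app {m : ℕ} {Letter : Type u} : Op m → Formula m Letter → Formula m Letter
  | .know a, α => .know a α
  | .next, α => .next α
  | .prev, α => .prev α

/-- The `k`-nested implication. The sequences `(β_0, …, β_k)` and `(X_1, …, X_k)` are given by
`β_0` and by the list `[(β_k, X_k), …, (β_1, X_1)]` (outermost pair first):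
`β_k → X_k (β_{k-1} → X_{k-1} (… (β_0 → τ)))`. -/
def nested {m : ℕ} {Letter : Type u} (β₀ : Formula m Letter) :
    List (Formula m Letter × Op m) → Formula m Letter → Formula m Letter
  | [], τ => .imp β₀ τ
  | (β, X) :: L, τ => .imp β (X.app (nested β₀ L τ))

/-! ### The axiom system -/

section Axiomatization

open Formula

variable {m : ℕ} {Letter : Type u}

/-- Instances of classical propositional tautologies: formulas that are true under every
truth assignment to formulas that respects negation and conjunction. -/
def IsTautology (φ : Formula m Letter) : Prop :=
  ∀ v : Formula m Letter → Prop,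
    (∀ α, v (neg α) ↔ ¬ v α) → (∀ α β, v (and α β) ↔ v α ∧ v β) → v φ

/-- Axioms. The letter `act a` says that the agent `a` is active. -/
inductive IsAxiom (act : Fin m → Letter) : Formula m Letter → Prop
  -- propositional axioms
  | taut (φ) : IsTautology φ → IsAxiom act φ
  -- time
  | next_neg (α) : IsAxiom act (iff (neg (next α)) (next (neg α)))
  | next_imp (α β) : IsAxiom act (imp (next (imp α β)) (imp (next α) (next β)))
  | til_next (α β) : IsAxiom act (iff (til α β) (or β (and α (next (til α β)))))
  | til_sometime (α β) : IsAxiom act (imp (til α β) (sometime β))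
  | prev_neg (α) : IsAxiom act (imp (neg (prev (neg α))) (prev α))
  | prev_imp (α β) : IsAxiom act (imp (prev (imp α β)) (imp (prev α) (prev β)))
  | prev_and (α β) : IsAxiom act (imp (and (prev α) (prev β)) (prev (and α β)))
  | next_prev (α) : IsAxiom act (iff (next (prev α)) α)
  | next_prev_comm₁ (α) : IsAxiom act (imp (next (prev α)) (prev (next α)))
  | next_prev_comm₂ (α γ) :
      IsAxiom act (imp (neg (prev (contra γ))) (iff (next (prev α)) (prev (next α))))
  | since_prev (α β) :
      IsAxiom act
        (iff (since α β)
          (or β (and (neg (prev (contra α))) (and α (prev (since α β))))))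
  | once_prev (β) : IsAxiom act (once (prev β))
  -- knowledge
  | know_imp (a α β) : IsAxiom act (imp (know a (imp α β)) (imp (know a α) (know a β)))
  | know_refl (a α) : IsAxiom act (imp (letter (act a)) (imp (know a α) α))
  | know_aware (a) : IsAxiom act (imp (letter (act a)) (know a (letter (act a))))
  | know_dead (a α) : IsAxiom act (imp (neg (letter (act a))) (know a (contra α)))
  | know_symm (a α) : IsAxiom act (imp (neg α) (know a (neg (know a α))))
  | know_trans (a α) : IsAxiom act (imp (know a α) (know a (know a α)))
  | common_everyone (α) (k : ℕ) : IsAxiom act (imp (common α) (everyone^[k] α))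
  -- probability on runs (`o = .run`) and on possible worlds (`o = .agent a`)
  | prob_zero (o α) (z : UnitQ) : (z : ℚ) = 0 → IsAxiom act (prob o z α)
  | prob_le_lt (o α) (r t : UnitQ) : r < t → IsAxiom act (imp (probLe o r α) (probLt o t α))
  | prob_lt_le (o α) (t : UnitQ) : IsAxiom act (imp (probLt o t α) (probLe o t α))
  | prob_add (o α β) (r t one u : UnitQ) :
      (one : ℚ) = 1 → (u : ℚ) = min 1 ((r : ℚ) + t) →
      IsAxiom act
        (imp (and (and (prob o r α) (prob o t β)) (prob o one (neg (and α β))))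
          (prob o u (or α β)))
  | prob_subadd (o α β) (r t u : UnitQ) :
      (u : ℚ) = r + t → IsAxiom act (imp (and (probLe o r α) (probLt o t β)) (probLt o u (or α β)))
  | prob_start (α) (one : UnitQ) :
      (one : ℚ) = 1 → IsAxiom act (prob .run one (prev (contra α)))

/-- `Rule Γ φ`: the formula `φ` follows from the set of premises `Γ` by modus ponens or by one of
the infinitary rules. -/
inductive Rule : Set (Formula m Letter) → Formula m Letter → Prop
  | mp (α β) : Rule {α, imp α β} β
  | til (β₀ L α β) :
      Rule (Set.range fun i : ℕ => nested β₀ L (neg (tilStep α β i)))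
        (nested β₀ L (neg (til α β)))
  | since (β₀ L α β) :
      Rule (Set.range fun i : ℕ => nested β₀ L (neg (sinceStep α β i)))
        (nested β₀ L (neg (since α β)))
  | common (β₀ L α) :
      Rule (Set.range fun i : ℕ => nested β₀ L (everyone^[i] α)) (nested β₀ L (common α))
  | archimedean (β₀ L o α) (r : UnitQ) : 0 < (r : ℚ) →
      Rule {φ | ∃ (i : ℕ) (s : UnitQ), 1 / (r : ℚ) ≤ i ∧ (s : ℚ) = r - 1 / i ∧
          φ = nested β₀ L (prob o s α)}
        (nested β₀ L (prob o r α))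

/-- `NecRule Γ φ`: the formula `φ` follows from the set of premises `Γ` by one of the
necessitation rules. -/
inductive NecRule : Set (Formula m Letter) → Formula m Letter → Prop
  | next (α) : NecRule {α} (next α)
  | prev (α) : NecRule {α} (prev α)
  | know (a α) : NecRule {α} (know a α)
  | prob (o α) (one : UnitQ) : (one : ℚ) = 1 → NecRule {α} (prob o one α)

/-- `α` is a theorem: there is a proof `s 0, s 1, …, s (l + 1) = α` whose length is an at most
countable successor ordinal. -/
def IsTheorem (act : Fin m → Letter) (α : Formula m Letter) : Prop :=
  ∃ l : Ordinal.{0}, l.card ≤ Cardinal.aleph0 ∧ ∃ s : Ordinal.{0} → Formula m Letter,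
    s (l + 1) = α ∧ ∀ i ≤ l + 1,
      IsAxiom act (s i) ∨
      ∃ Γ, (Rule Γ (s i) ∨ NecRule Γ (s i)) ∧ ∀ γ ∈ Γ, ∃ j < i, s j = γ

/-- `α` is derivable from `T`: as for theorems, but formulas of `T` may be used, and the premises
of the necessitation rules must be theorems. -/
def Derivable (act : Fin m → Letter) (T : Set (Formula m Letter)) (α : Formula m Letter) : Prop :=
  ∃ l : Ordinal.{0}, l.card ≤ Cardinal.aleph0 ∧ ∃ s : Ordinal.{0} → Formula m Letter,
    s (l + 1) = α ∧ ∀ i ≤ l + 1,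
      IsAxiom act (s i) ∨ s i ∈ T ∨
      ∃ Γ, (Rule Γ (s i) ∨ (NecRule Γ (s i) ∧ ∀ γ ∈ Γ, IsTheorem act γ)) ∧
        ∀ γ ∈ Γ, ∃ j < i, s j = γ

/-- A set of formulas is consistent if some formula is not derivable from it. -/
def Consistent (act : Fin m → Letter) (T : Set (Formula m Letter)) : Prop :=
  ¬ ∀ α, Derivable act T α

end Axiomatization

/-! ### Semantics -/

/-- A finitely additive probability space on the set `X`: an algebra of subsets of `X` and a
finitely additive probability measure on it with values in `[0, 1]`
(the values of `μ` outside the algebra are irrelevant). -/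
structure FinAddProb (X : Type u) : Type u where
  alg : Set (Set X)
  isSetAlgebra : MeasureTheory.IsSetAlgebra alg
  μ : Set X → ℝ
  mem_unit : ∀ A ∈ alg, μ A ∈ Set.Icc (0 : ℝ) 1
  μ_univ : μ Set.univ = 1
  μ_union : ∀ A ∈ alg, ∀ B ∈ alg, Disjoint A B → μ (A ∪ B) = μ A + μ B

/-- Models. The runs form a nonempty family: `val r` is the run `ℕ → 𝒫(Letter)` with index `r`.
Possible worlds are pairs `(r, n)`, and an agent `a` is active in `(r, n)` if and only if the
letter `act a` belongs to `val r n`. -/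
structure Model {m : ℕ} {Letter : Type u} (act : Fin m → Letter) : Type (u + 1) where
  Run : Type u
  nonempty_run : Nonempty Run
  val : Run → ℕ → Set Letter
  /-- the set of active agents -/
  active : Run × ℕ → Set (Fin m)
  mem_active : ∀ a r n, a ∈ active (r, n) ↔ act a ∈ val r n
  /-- accessibility relations -/
  acc : Fin m → Run × ℕ → Run × ℕ → Prop
  acc_symm : ∀ a w w', acc a w w' → acc a w' w
  acc_trans : ∀ a w w' w'', acc a w w' → acc a w' w'' → acc a w w''
  acc_dead : ∀ a w, a ∉ active w ↔ ∀ w', ¬ acc a w w'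
  acc_refl : ∀ a w, a ∈ active w → acc a w w
  /-- probability on runs -/
  runProb : Run × ℕ → FinAddProb Run
  /-- the sample space of an agent in a world -/
  space : Fin m → Run × ℕ → Set (Run × ℕ)
  nonempty_space : ∀ a w, (space a w).Nonempty
  /-- probability on possible worlds -/
  agentProb : (a : Fin m) → (w : Run × ℕ) → FinAddProb (space a w)

namespace Model

variable {m : ℕ} {Letter : Type u} {act : Fin m → Letter} (M : Model act)

/-- The set of possible worlds. -/
abbrev World : Type u := M.Run × ℕ

/-- All agents know the property `S`. -/
def everyone (S : M.World → Prop) (w : M.World) : Prop := ∀ a w', M.acc a w w' → S w'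

/-- The satisfiability relation. The clause for common knowledge iterates `everyone`;
see `sat_common` for the formulation through the formulas `E^k β`. -/
def Sat : M.World → Formula m Letter → Prop
  | w, .letter p => p ∈ M.val w.1 w.2
  | w, .neg β => ¬ Sat w β
  | w, .and α β => Sat w α ∧ Sat w β
  | w, .next β => Sat (w.1, w.2 + 1) β
  | w, .til α β => ∃ j, w.2 ≤ j ∧ Sat (w.1, j) β ∧ ∀ k, w.2 ≤ k → k < j → Sat (w.1, k) α
  | w, .prev β => w.2 = 0 ∨ (1 ≤ w.2 ∧ Sat (w.1, w.2 - 1) β)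
  | w, .since α β => ∃ j, j ≤ w.2 ∧ Sat (w.1, j) β ∧ ∀ k, j < k → k ≤ w.2 → Sat (w.1, k) α
  | w, .know a β => ∀ w', M.acc a w w' → Sat w' β
  | w, .common β => ∀ k : ℕ, (M.everyone^[k] fun w' => Sat w' β) w
  | w, .prob .run s β => ((s : ℚ) : ℝ) ≤ (M.runProb w).μ {r | Sat (r, 0) β}
  | w, .prob (.agent a) s β => ((s : ℚ) : ℝ) ≤ (M.agentProb a w).μ {w' | Sat w'.1 β}

theorem sat_conj (w : M.World) (t : Formula m Letter) (ht : M.Sat w t) :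
    ∀ l : List (Formula m Letter), M.Sat w (.conj t l) ↔ ∀ α ∈ l, M.Sat w α
  | [] => by simpa [Formula.conj] using ht
  | [α] => by simp [Formula.conj]
  | α :: β :: l => by
      rw [Formula.conj, Sat, sat_conj w t ht (β :: l)]
      simp

theorem sat_everyone (w : M.World) (α : Formula m Letter) :
    M.Sat w α.everyone ↔ M.everyone (fun w' => M.Sat w' α) w := by
  rw [Formula.everyone, sat_conj M w _ (by simp [Formula.imp, Sat])]
  simp [everyone, Sat]

/-- `C β` holds in `w` if and only if all the formulas `E^k β` hold in `w`. -/
theorem sat_common (w : M.World) (β : Formula m Letter) :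
    M.Sat w (.common β) ↔ ∀ k : ℕ, M.Sat w (Formula.everyone^[k] β) := by
  have key : ∀ (k : ℕ) (w : M.World),
      M.Sat w (Formula.everyone^[k] β) ↔ (M.everyone^[k] fun w' => M.Sat w' β) w := by
    intro k
    induction k with
    | zero => intro w; rfl
    | succ k ih =>
      intro w
      rw [Function.iterate_succ_apply', Function.iterate_succ_apply', sat_everyone]
      simp only [everyone, ih]
  simp only [Sat, key]

/-- A model is measurable if all the sets of runs and of worlds defined by formulas belong to the
corresponding algebras. -/
def Measurable : Prop :=
  ∀ (w : M.World) (β : Formula m Letter),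
    {r | M.Sat (r, 0) β} ∈ (M.runProb w).alg ∧
    ∀ a, {w' : M.space a w | M.Sat w'.1 β} ∈ (M.agentProb a w).alg

end Model

/-- A set of formulas is satisfiable if it is satisfied in a possible world of a measurable
model. -/
def Satisfiable {m : ℕ} {Letter : Type u} (act : Fin m → Letter)
    (T : Set (Formula m Letter)) : Prop :=
  ∃ M : Model act, M.Measurable ∧ ∃ w : M.World, ∀ α ∈ T, M.Sat w α

end PTEL

namespace PTEL

universe u

open Formula

/-! Soundness is an induction on derivations. An inference that is valid at every single world stays
valid inside a nested implication, because the operators occurring there quantify universally over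
worlds (`Model.sat_nested_of_forall`). The additivity axioms for probability reduce to
inclusion-exclusion.

Completeness is a canonical model argument in which the infinitary rules stand in for compactness.
Derivations are treated as well-founded trees; over a countable language such a tree flattens to a
sequence of countable ordinal length (`Generated.exists_seq`). The infinitary rules are stated for
nested implications, so they are stable under an extra hypothesis and under an extra operator. This
yields the deduction theorem (`Der.deduction`) and strong necessitation (`Der.op`). A union of a
chain of consistent sets need not respect infinitary rules, so the Lindenbaum construction
`Con.exists_mcs` also adds, for each of the countably many rule instances, its conclusion or the
negation of one of its premises.

The canonical runs are the maximal consistent sets that describe an initial state, and time is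
iteration of `nextSet`. The axiom `once_prev` forces every maximal consistent set to lie finitely
many steps after an initial one (`MCS.exists_state`). Hence truth in all canonical worlds amounts to
provability, which supplies enough accessible worlds and makes the agents' measures well defined;
for measures on runs, `prob_start` reduces the matter to initial states. The measure of the
extension of a formula is the supremum of its provable lower bounds: the Archimedean rule makes that
supremum exact (`MCS.le_probSup_iff`), and the probability axioms make it additive
(`MCS.probSup_or`). The truth lemma `sat_canonicalModel` combines these facts. -/

/-! ### Inductive derivations and proof sequences -/

section Generated

variable {F : Type u}

/-- The least set of formulas closed under all steps from premises to a conclusion. -/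
inductive Generated (Step : Set F → F → Prop) : F → Prop
  | step {Γ α} : Step Γ α → (∀ γ ∈ Γ, Generated Step γ) → Generated Step α

/-- Countably many blocks of ordinals of lengths `l n + 2` can be placed one after another. -/
theorem exists_concat (l : ℕ → Ordinal.{0}) (hl : ∀ n, (l n).card ≤ Cardinal.aleph0)
    (s : ℕ → Ordinal.{0} → F) (α : F) :
    ∃ L : Ordinal.{0}, L.card ≤ Cardinal.aleph0 ∧ ∃ (o : ℕ → Ordinal.{0}) (S : Ordinal.{0} → F),
      (∀ n, ∀ j ≤ l n + 1, o n + j < L ∧ S (o n + j) = s n j) ∧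
      (∀ i < L, ∃ n, ∃ j ≤ l n + 1, i = o n + j) ∧ ∀ i, L ≤ i → S i = α := by
  classical
  let o : ℕ → Ordinal.{0} := fun n => Nat.rec 0 (fun n x => x + (l n + 1 + 1)) n
  have o_succ : ∀ n, o (n + 1) = o n + (l n + 1 + 1) := fun n => rfl
  have o_mono : Monotone o := monotone_nat_of_le_succ fun n => by rw [o_succ]; exact le_self_add
  have o_lt : ∀ n j, j ≤ l n + 1 → o n + j < o (n + 1) := fun n j hj => by
    rw [o_succ]
    exact add_lt_add_right (Order.lt_add_one_iff.2 hj) _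
  have card_o : ∀ n, (o n).card ≤ Cardinal.aleph0 := by
    intro n
    induction n with
    | zero => simp [o]
    | succ n ih =>
      rw [o_succ]
      simp only [Ordinal.card_add, Ordinal.card_one]
      exact Cardinal.add_le_aleph0.2 ⟨ih, Cardinal.add_le_aleph0.2
        ⟨Cardinal.add_le_aleph0.2 ⟨hl n, Cardinal.one_le_aleph0⟩, Cardinal.one_le_aleph0⟩⟩
  have le_sup : ∀ n, o n ≤ ⨆ n, o n := fun n => Ordinal.le_iSup o n
  -- Block `n` occupies the ordinals from `o n` up to, but excluding, `o (n + 1)`; `blk i` recovers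
  -- the block of `i`.
  let blk : Ordinal.{0} → ℕ := fun i => sInf {n | i < o (n + 1)}
  have blk_eq : ∀ n i, o n ≤ i → i < o (n + 1) → blk i = n := by
    intro n i h1 h2
    have hmem : blk i ∈ {n | i < o (n + 1)} := Nat.sInf_mem ⟨n, h2⟩
    refine le_antisymm (Nat.sInf_le h2) ?_
    by_contra hlt
    have hn : blk i + 1 ≤ n := by omega
    have hle : o (blk i + 1) ≤ o n := o_mono hn
    exact absurd (hle.trans h1) (not_le.2 hmem)
  refine ⟨⨆ n, o n, ?_, o, fun i => if i < ⨆ n, o n then s (blk i) (i - o (blk i)) else α,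
    ?_, ?_, fun i hi => if_neg (not_lt.2 hi)⟩
  · exact Ordinal.card_iSup_le Cardinal.mk_le_aleph0 card_o
  · intro n j hj
    have h := (o_lt n j hj).trans_le (le_sup (n + 1))
    refine ⟨h, ?_⟩
    simp only [if_pos h]
    rw [blk_eq n _ le_self_add (o_lt n j hj), Ordinal.add_sub_cancel]
  · intro i hi
    obtain ⟨k, hk⟩ := (Ordinal.lt_iSup_iff).1 hi
    have hmem : ∃ n, i < o (n + 1) := ⟨k, hk.trans_le (o_mono (Nat.le_succ k))⟩
    have h1 : i < o (Nat.find hmem + 1) := Nat.find_spec hmem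
    have h2 : o (Nat.find hmem) ≤ i := by
      rcases hn : Nat.find hmem with _ | n
      · exact zero_le
      · exact not_lt.1 (Nat.find_min hmem (by omega))
    refine ⟨Nat.find hmem, i - o (Nat.find hmem), ?_, (Ordinal.add_sub_cancel_of_le h2).symm⟩
    rw [o_succ] at h1
    rw [← Order.lt_add_one_iff]
    exact (Ordinal.sub_lt_of_le h2).2 h1

/-- By induction on the tree: a countable formula type leaves only countably many premises, so their
sequences can be concatenated and followed by the conclusion. -/
theorem Generated.exists_seq [Countable F] {Step : Set F → F → Prop} {α : F}
    (h : Generated Step α) :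
    ∃ l : Ordinal.{0}, l.card ≤ Cardinal.aleph0 ∧ ∃ s : Ordinal.{0} → F,
      s (l + 1) = α ∧ ∀ i ≤ l + 1, ∃ Γ, Step Γ (s i) ∧ ∀ γ ∈ Γ, ∃ j < i, s j = γ := by
  induction h with
  | @step Γ α hstep hΓ ih =>
    rcases Γ.eq_empty_or_nonempty with rfl | hne
    · exact ⟨0, by simp, fun _ => α, rfl, fun i _ => ⟨∅, hstep, by simp⟩⟩
    obtain ⟨f, rfl⟩ := (Set.to_countable Γ).exists_eq_range hne
    choose l hl s hs hproof using fun n => ih (f n) ⟨n, rfl⟩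
    obtain ⟨L, hL, o, S, h1, h2, h3⟩ := exists_concat l hl s α
    -- The required shape ends at position `L + 1`, so the conclusion is simply written twice, at
    -- `L` and at `L + 1`.
    refine ⟨L, hL, S, h3 _ le_self_add, fun i _ => ?_⟩
    by_cases hi : i < L
    · obtain ⟨n, j, hj, rfl⟩ := h2 i hi
      rw [(h1 n j hj).2]
      obtain ⟨Γ, hΓ', h⟩ := hproof n j hj
      refine ⟨Γ, hΓ', fun γ hγ => ?_⟩
      obtain ⟨k, hk, rfl⟩ := h γ hγ
      exact ⟨o n + k, add_lt_add_right hk _, (h1 n k (hk.le.trans hj)).2⟩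
    · rw [h3 i (not_lt.1 hi)]
      refine ⟨_, hstep, ?_⟩
      rintro _ ⟨n, rfl⟩
      exact ⟨o n + (l n + 1), (h1 n _ le_rfl).1.trans_le (not_lt.1 hi),
        ((h1 n _ le_rfl).2).trans (hs n)⟩

end Generated

/-! ### The language is countable -/

section Countable

variable {m : ℕ} {Letter : Type u}

instance : Countable (Op m) :=
  Function.Injective.countable (f := fun X : Op m => match X with
    | .know a => (Sum.inl a : Fin m ⊕ Bool) | .next => .inr true | .prev => .inr false)
    (by rintro (_ | _ | _) (_ | _ | _) <;> simp)

instance : Countable (ProbIdx m) :=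
  Function.Injective.countable (f := fun X : ProbIdx m => match X with
    | .run => none | .agent a => some a)
    (by rintro (_ | _) (_ | _) <;> simp)

/-- A code of a formula, for given codes of letters and of probability operators. -/
def Formula.code (f : Letter → ℕ) (g : ProbIdx m × UnitQ → ℕ) : Formula m Letter → ℕ
  | letter p => Nat.pair 0 (f p)
  | neg α => Nat.pair 1 (α.code f g)
  | and α β => Nat.pair 2 (Nat.pair (α.code f g) (β.code f g))
  | next α => Nat.pair 3 (α.code f g)
  | til α β => Nat.pair 4 (Nat.pair (α.code f g) (β.code f g))
  | prev α => Nat.pair 5 (α.code f g)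
  | since α β => Nat.pair 6 (Nat.pair (α.code f g) (β.code f g))
  | know a α => Nat.pair 7 (Nat.pair a (α.code f g))
  | common α => Nat.pair 8 (α.code f g)
  | prob o s α => Nat.pair 9 (Nat.pair (g (o, s)) (α.code f g))

theorem Formula.code_injective {f : Letter → ℕ} {g : ProbIdx m × UnitQ → ℕ}
    (hf : f.Injective) (hg : g.Injective) : (Formula.code f g).Injective := by
  intro α
  induction α with
  | letter p => intro β h; cases β <;> simp [code, hf.eq_iff] at h ⊢; exact h
  | neg α ih => intro β h; cases β <;> simp [code] at h ⊢; exact ih h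
  | and α β ih₁ ih₂ => intro γ h; cases γ <;> simp [code] at h ⊢; exact ⟨ih₁ h.1, ih₂ h.2⟩
  | next α ih => intro β h; cases β <;> simp [code] at h ⊢; exact ih h
  | til α β ih₁ ih₂ => intro γ h; cases γ <;> simp [code] at h ⊢; exact ⟨ih₁ h.1, ih₂ h.2⟩
  | prev α ih => intro β h; cases β <;> simp [code] at h ⊢; exact ih h
  | since α β ih₁ ih₂ => intro γ h; cases γ <;> simp [code] at h ⊢; exact ⟨ih₁ h.1, ih₂ h.2⟩
  | know a α ih =>
    intro β h; cases β <;> simp [code] at h ⊢; exact ⟨Fin.ext h.1, ih h.2⟩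
  | common α ih => intro β h; cases β <;> simp [code] at h ⊢; exact ih h
  | prob o s α ih =>
    intro β h
    cases β <;> simp [code, hg.eq_iff] at h ⊢
    exact ⟨h.1.1, h.1.2, ih h.2⟩

instance [Countable Letter] : Countable (Formula m Letter) := by
  obtain ⟨f, hf⟩ := exists_injective_nat Letter
  obtain ⟨g, hg⟩ := exists_injective_nat (ProbIdx m × UnitQ)
  exact (Formula.code_injective hf hg).countable

end Countable

/-! ### Derivability, inductively -/

section Derivations

variable {m : ℕ} {Letter : Type u}

/-- Inductive form of `IsTheorem`. -/
inductive Thm (act : Fin m → Letter) : Formula m Letter → Prop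
  | ax {α} : IsAxiom act α → Thm act α
  | rule {Γ α} : Rule Γ α → (∀ γ ∈ Γ, Thm act γ) → Thm act α
  | nec {Γ α} : NecRule Γ α → (∀ γ ∈ Γ, Thm act γ) → Thm act α

/-- Inductive form of `Derivable`. -/
inductive Der (act : Fin m → Letter) (T : Set (Formula m Letter)) : Formula m Letter → Prop
  | thm {α} : Thm act α → Der act T α
  | hyp {α} : α ∈ T → Der act T α
  | rule {Γ α} : Rule Γ α → (∀ γ ∈ Γ, Der act T γ) → Der act T α

variable {act : Fin m → Letter} {T : Set (Formula m Letter)} {α : Formula m Letter}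

theorem IsTheorem.thm (h : IsTheorem act α) : Thm act α := by
  obtain ⟨l, -, s, rfl, hs⟩ := h
  suffices ∀ i ≤ l + 1, Thm act (s i) from this _ le_rfl
  intro i
  induction i using WellFoundedLT.induction with
  | _ i ih =>
    intro hi
    have key : ∀ Γ : Set (Formula m Letter), (∀ γ ∈ Γ, ∃ j < i, s j = γ) →
        ∀ γ ∈ Γ, Thm act γ := by
      rintro Γ h γ hγ
      obtain ⟨j, hj, rfl⟩ := h γ hγ
      exact ih j hj (hj.le.trans hi)
    rcases hs i hi with h | ⟨Γ, h | h, hΓ⟩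
    · exact .ax h
    · exact .rule h (key Γ hΓ)
    · exact .nec h (key Γ hΓ)

theorem Derivable.der (h : Derivable act T α) : Der act T α := by
  obtain ⟨l, -, s, rfl, hs⟩ := h
  suffices ∀ i ≤ l + 1, Der act T (s i) from this _ le_rfl
  intro i
  induction i using WellFoundedLT.induction with
  | _ i ih =>
    intro hi
    rcases hs i hi with h | h | ⟨Γ, h | ⟨h, hthm⟩, hΓ⟩
    · exact .thm (.ax h)
    · exact .hyp h
    · refine .rule h fun γ hγ => ?_
      obtain ⟨j, hj, rfl⟩ := hΓ γ hγ
      exact ih j hj (hj.le.trans hi)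
    -- Necessitation is applied only to theorems, so its conclusion is again a theorem and `Der`
    -- needs no necessitation clause.
    · exact .thm (.nec h fun γ hγ => (hthm γ hγ).thm)

theorem Thm.isTheorem [Countable Letter] (h : Thm act α) : IsTheorem act α := by
  have : Generated (fun Γ φ => (Γ = ∅ ∧ IsAxiom act φ) ∨ Rule Γ φ ∨ NecRule Γ φ) α := by
    induction h with
    | ax h => exact .step (.inl ⟨rfl, h⟩) (by simp)
    | rule h _ ih => exact .step (.inr (.inl h)) ih
    | nec h _ ih => exact .step (.inr (.inr h)) ih
  obtain ⟨l, hl, s, hs, h⟩ := this.exists_seq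
  refine ⟨l, hl, s, hs, fun i hi => ?_⟩
  obtain ⟨Γ, ⟨-, h⟩ | h, hΓ⟩ := h i hi
  · exact .inl h
  · exact .inr ⟨Γ, h, hΓ⟩

theorem Der.derivable [Countable Letter] (h : Der act T α) : Derivable act T α := by
  have : Generated (fun Γ φ => (Γ = ∅ ∧ (IsAxiom act φ ∨ φ ∈ T)) ∨
      Rule Γ φ ∨ (NecRule Γ φ ∧ ∀ γ ∈ Γ, IsTheorem act γ)) α := by
    induction h with
    | thm h =>
      -- `Derivable` has no clause for citing a theorem, so the whole derivation of the theorem is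
      -- replayed.
      induction h with
      | ax h => exact .step (.inl ⟨rfl, .inl h⟩) (by simp)
      | rule h _ ih => exact .step (.inr (.inl h)) ih
      | nec h hΓ ih => exact .step (.inr (.inr ⟨h, fun γ hγ => (hΓ γ hγ).isTheorem⟩)) ih
    | hyp h => exact .step (.inl ⟨rfl, .inr h⟩) (by simp)
    | rule h _ ih => exact .step (.inr (.inl h)) ih
  obtain ⟨l, hl, s, hs, h⟩ := this.exists_seq
  refine ⟨l, hl, s, hs, fun i hi => ?_⟩
  obtain ⟨Γ, ⟨-, h | h⟩ | h, hΓ⟩ := h i hi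
  · exact .inl h
  · exact .inr (.inl h)
  · exact .inr (.inr ⟨Γ, h, hΓ⟩)

end Derivations

/-! ### Propositional reasoning, deduction theorem and strong necessitation -/

section ProofTheory

variable {m : ℕ} {Letter : Type u} {act : Fin m → Letter}

/-- Truth assignments to formulas that respect negation and conjunction. -/
structure IsValuation (v : Formula m Letter → Prop) : Prop where
  neg : ∀ α, v (neg α) ↔ ¬ v α
  and : ∀ α β, v (and α β) ↔ v α ∧ v β

namespace IsValuation

theorem conj {v : Formula m Letter → Prop} (hv : IsValuation v) {t : Formula m Letter}
    (ht : v t) : ∀ l : List (Formula m Letter), v (.conj t l) ↔ ∀ α ∈ l, v α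
  | [] => by simpa [Formula.conj] using ht
  | [α] => by simp [Formula.conj]
  | α :: β :: l => by
      rw [Formula.conj, hv.and, IsValuation.conj hv ht (β :: l)]
      simp

variable {v : Formula m Letter → Prop} (hv : IsValuation v) (α β : Formula m Letter)
include hv

theorem imp : v (imp α β) ↔ (v α → v β) := by
  simp only [Formula.imp, hv.neg, hv.and]; tauto

theorem or : v (or α β) ↔ v α ∨ v β := by
  simp only [Formula.or, hv.neg, hv.and]; tauto

theorem iff : v (iff α β) ↔ (v α ↔ v β) := by
  simp only [Formula.iff, hv.imp, hv.and]; tauto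

theorem contra : ¬ v (contra α) := by
  simp only [Formula.contra, hv.neg, hv.and]; tauto

theorem everyone : v (everyone α) ↔ ∀ a, v (know a α) := by
  rw [Formula.everyone, hv.conj ((hv.imp _ _).2 id)]
  simp

theorem tilStep (i : ℕ) :
    v (tilStep α β i) ↔ (∀ l < i, v (next^[l] α)) ∧ v (next^[i] β) := by
  rw [Formula.tilStep, hv.and, hv.conj ((hv.imp _ _).2 id)]
  simp only [List.forall_mem_map, List.mem_range]

theorem sinceStep (i : ℕ) :
    v (sinceStep α β i) ↔ (∀ l < i, v (prev^[l] α)) ∧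
      (∀ l ≤ i, ¬ v (prev^[l] (Formula.contra α))) ∧ v (prev^[i] β) := by
  rw [Formula.sinceStep, hv.and, hv.and, hv.conj ((hv.imp _ _).2 id),
    hv.conj ((hv.imp _ _).2 id)]
  simp only [List.forall_mem_map, List.mem_range, hv.neg, Nat.lt_succ_iff, and_assoc]

end IsValuation

/-- Replaces Hilbert-style propositional derivations by truth-value computations. -/
theorem Thm.of_valuation {α : Formula m Letter}
    (h : ∀ v : Formula m Letter → Prop, IsValuation v → v α) : Thm act α :=
  .ax (.taut _ fun v hn ha => h v ⟨hn, ha⟩)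

variable {T : Set (Formula m Letter)} {α β γ φ ψ : Formula m Letter}

theorem Thm.mp (h₁ : Thm act α) (h₂ : Thm act (imp α β)) : Thm act β :=
  .rule (.mp α β) (by rintro _ (rfl | rfl) <;> assumption)

theorem Der.mp (h₁ : Der act T α) (h₂ : Der act T (imp α β)) : Der act T β :=
  .rule (.mp α β) (by rintro _ (rfl | rfl) <;> assumption)

theorem Der.of_valuation (h₁ : Der act T α)
    (h : ∀ v : Formula m Letter → Prop, IsValuation v → v α → v β) : Der act T β :=
  h₁.mp (.thm (.of_valuation fun v hv => (hv.imp _ _).2 (h v hv)))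

theorem Der.of_valuation₂ (h₁ : Der act T α) (h₂ : Der act T β)
    (h : ∀ v : Formula m Letter → Prop, IsValuation v → v α → v β → v γ) : Der act T γ :=
  h₂.mp (h₁.of_valuation fun v hv hα => (hv.imp _ _).2 (h v hv hα))

theorem Der.mono {T' : Set (Formula m Letter)} (hT : T ⊆ T') (h : Der act T α) :
    Der act T' α := by
  induction h with
  | thm h => exact .thm h
  | hyp h => exact .hyp (hT h)
  | rule h _ ih => exact .rule h ih

theorem Der.thm_of_empty (h : Der act ∅ α) : Thm act α := by
  induction h with
  | thm h => exact h
  | hyp h => exact h.elim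
  | rule h _ ih => exact .rule h ih

/-- The infinitary rules, without the nested implications around their premises and
conclusions. -/
inductive InfRule : Set (Formula m Letter) → Formula m Letter → Prop
  | til (α β : Formula m Letter) : InfRule (Set.range fun i : ℕ => neg (tilStep α β i)) (neg (til α β))
  | since (α β : Formula m Letter) : InfRule (Set.range fun i : ℕ => neg (sinceStep α β i)) (neg (since α β))
  | common (α : Formula m Letter) : InfRule (Set.range fun i : ℕ => Formula.everyone^[i] α) (common α)
  | archimedean (o : ProbIdx m) (α : Formula m Letter) (r : UnitQ) : 0 < (r : ℚ) →
      InfRule {φ | ∃ (i : ℕ) (s : UnitQ), 1 / (r : ℚ) ≤ i ∧ (s : ℚ) = r - 1 / i ∧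
          φ = prob o s α} (prob o r α)

variable {S Γ : Set (Formula m Letter)} {τ : Formula m Letter}

theorem InfRule.rule (h : InfRule S τ) (β₀ : Formula m Letter)
    (L : List (Formula m Letter × Op m)) : Rule (nested β₀ L '' S) (nested β₀ L τ) := by
  cases h with
  | til α β => rw [← Set.range_comp]; exact .til β₀ L α β
  | since α β => rw [← Set.range_comp]; exact .since β₀ L α β
  | common α => rw [← Set.range_comp]; exact .common β₀ L α
  | archimedean o α r hr =>
    convert! Rule.archimedean β₀ L o α r hr using 1
    ext φ
    constructor
    · rintro ⟨_, ⟨i, s, h₁, h₂, rfl⟩, rfl⟩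
      exact ⟨i, s, h₁, h₂, rfl⟩
    · rintro ⟨i, s, h₁, h₂, rfl⟩
      exact ⟨_, ⟨i, s, h₁, h₂, rfl⟩, rfl⟩

theorem Rule.mp_or_infRule (h : Rule Γ φ) :
    (∃ α, Γ = {α, imp α φ}) ∨
    ∃ β₀ L S τ, InfRule S τ ∧ Γ = nested β₀ L '' S ∧ φ = nested β₀ L τ := by
  cases h with
  | mp α β => exact .inl ⟨α, rfl⟩
  | til β₀ L α β => exact .inr ⟨β₀, L, _, _, .til α β, by rw [← Set.range_comp]; rfl, rfl⟩
  | since β₀ L α β => exact .inr ⟨β₀, L, _, _, .since α β, by rw [← Set.range_comp]; rfl, rfl⟩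
  | common β₀ L α => exact .inr ⟨β₀, L, _, _, .common α, by rw [← Set.range_comp]; rfl, rfl⟩
  | archimedean β₀ L o α r hr =>
    refine .inr ⟨β₀, L, _, _, .archimedean o α r hr, ?_, rfl⟩
    ext φ
    constructor
    · rintro ⟨i, s, h₁, h₂, rfl⟩
      exact ⟨_, ⟨i, s, h₁, h₂, rfl⟩, rfl⟩
    · rintro ⟨_, ⟨i, s, h₁, h₂, rfl⟩, rfl⟩
      exact ⟨i, s, h₁, h₂, rfl⟩

theorem Der.infRule (h : InfRule S τ) (β₀ : Formula m Letter)
    (L : List (Formula m Letter × Op m)) (hS : ∀ σ ∈ S, Der act T (nested β₀ L σ)) :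
    Der act T (nested β₀ L τ) :=
  .rule (h.rule β₀ L) (by rintro _ ⟨σ, hσ, rfl⟩; exact hS σ hσ)

theorem Der.infRule' (h : InfRule S τ) (hS : ∀ σ ∈ S, Der act T σ) : Der act T τ :=
  -- The bare rule is the 0-nested one with a tautology as antecedent.
  (Der.infRule h (imp τ τ) [] fun σ hσ =>
    (hS σ hσ).of_valuation fun _ hv h => (hv.imp _ _).2 fun _ => h).of_valuation
      fun _ hv h => (hv.imp _ _).1 h ((hv.imp _ _).2 id)

/-- Induction on derivations with the rules in the form modus ponens and `InfRule`. -/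
theorem Der.induct {P : Formula m Letter → Prop} (thm : ∀ α, Thm act α → P α)
    (hyp : ∀ α ∈ T, P α) (mp : ∀ α β, P α → P (imp α β) → P β)
    (inf : ∀ β₀ L S τ, InfRule S τ → (∀ σ ∈ S, P (nested β₀ L σ)) → P (nested β₀ L τ))
    (h : Der act T φ) : P φ := by
  induction h with
  | thm h => exact thm _ h
  | hyp h => exact hyp _ h
  | @rule Γ φ h _ ih =>
    rcases h.mp_or_infRule with ⟨α, rfl⟩ | ⟨β₀, L, S, τ, hi, rfl, rfl⟩
    · exact mp α φ (ih _ (.inl rfl)) (ih _ (.inr rfl))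
    · exact inf β₀ L S τ hi fun σ hσ => ih _ ⟨σ, hσ, rfl⟩

/-- An implication into a nested implication is again a nested implication. -/
theorem exists_nested_imp (φ β₀ : Formula m Letter) (L : List (Formula m Letter × Op m)) :
    ∃ β₀' L', ∀ τ, ∀ v : Formula m Letter → Prop, IsValuation v →
      (v (nested β₀' L' τ) ↔ v (imp φ (nested β₀ L τ))) := by
  -- The new hypothesis is conjoined to the outermost antecedent.
  rcases L with _ | ⟨⟨β, X⟩, L⟩
  · refine ⟨.and φ β₀, [], fun τ v hv => ?_⟩
    simp only [nested, hv.imp, hv.and]; tauto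
  · refine ⟨β₀, (.and φ β, X) :: L, fun τ v hv => ?_⟩
    simp only [nested, hv.imp, hv.and]; tauto

/-- Only the infinitary rules need thought: by `exists_nested_imp`, prefixing `φ` to premises and
conclusion gives another instance of the same rule, up to propositional equivalence. -/
theorem Der.deduction (h : Der act (insert φ T) ψ) : Der act T (imp φ ψ) := by
  refine Der.induct (P := fun ψ => Der act T (imp φ ψ)) ?_ ?_ ?_ ?_ h
  · intro α h
    exact (Der.thm h).of_valuation fun v hv h => (hv.imp _ _).2 fun _ => h
  · rintro α (rfl | h)
    · exact .thm (.of_valuation fun v hv => (hv.imp _ _).2 id)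
    · exact (Der.hyp h).of_valuation fun v hv h => (hv.imp _ _).2 fun _ => h
  · intro α β h₁ h₂
    refine h₁.of_valuation₂ h₂ fun v hv => ?_
    simp only [hv.imp]; tauto
  · intro β₀ L S τ h hS
    obtain ⟨β₀', L', heq⟩ := exists_nested_imp φ β₀ L
    exact (Der.infRule h β₀' L' fun σ hσ =>
      (hS σ hσ).of_valuation fun v hv => (heq σ v hv).2).of_valuation fun v hv => (heq τ v hv).1

theorem Thm.op (X : Op m) (h : Thm act α) : Thm act (X.app α) := by
  cases X with
  | know a => exact .nec (.know a α) (by rintro _ rfl; exact h)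
  | next => exact .nec (.next α) (by rintro _ rfl; exact h)
  | prev => exact .nec (.prev α) (by rintro _ rfl; exact h)

theorem Thm.op_imp (X : Op m) (α β : Formula m Letter) :
    Thm act (imp (X.app (imp α β)) (imp (X.app α) (X.app β))) := by
  cases X with
  | know a => exact .ax (.know_imp a α β)
  | next => exact .ax (.next_imp α β)
  | prev => exact .ax (.prev_imp α β)

/-- Strong necessitation. Theorems use plain necessitation and modus ponens uses distribution of
`X`; an infinitary rule is applied one nesting level deeper, under `X` with a tautological
antecedent. -/
theorem Der.op (X : Op m) (h : Der act T ψ) : Der act (X.app '' T) (X.app ψ) := by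
  refine Der.induct (P := fun ψ => Der act (X.app '' T) (X.app ψ)) ?_ ?_ ?_ ?_ h
  · exact fun α h => .thm (h.op X)
  · exact fun α h => .hyp ⟨α, h, rfl⟩
  · exact fun α β h₁ h₂ => h₁.mp (h₂.mp (.thm (.op_imp X α β)))
  · intro β₀ L S τ h hS
    refine (Der.infRule h β₀ ((imp β₀ β₀, X) :: L) fun σ hσ => ?_).of_valuation
      (β := X.app (nested β₀ L τ)) fun v hv h => (hv.imp _ _).1 h ((hv.imp _ _).2 id)
    exact (hS σ hσ).of_valuation fun v hv h => (hv.imp _ _).2 fun _ => h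

end ProofTheory

/-! ### Maximal consistent sets -/

section MCS

variable {m : ℕ} {Letter : Type u} {act : Fin m → Letter}
  {T Γ Δ : Set (Formula m Letter)} {α β φ ψ : Formula m Letter}

/-- Consistency with respect to the inductive derivability relation. -/
def Con (act : Fin m → Letter) (T : Set (Formula m Letter)) : Prop := ∃ φ, ¬ Der act T φ

/-- Maximal consistent sets: deductively closed sets that contain exactly one of `φ` and `¬ φ`. -/
structure MCS (act : Fin m → Letter) (Γ : Set (Formula m Letter)) : Prop where
  closed : ∀ {φ}, Der act Γ φ → φ ∈ Γ
  neg_mem : ∀ φ, neg φ ∈ Γ ↔ φ ∉ Γ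

theorem Con.neg_not_der (h : Con act T) (h₁ : Der act T φ) : ¬ Der act T (neg φ) := by
  obtain ⟨ψ, hψ⟩ := h
  exact fun h₂ => hψ (h₁.of_valuation₂ h₂ fun v hv h h' => absurd h ((hv.neg _).1 h'))

theorem Der.neg_of_not_con (h : ¬ Con act (insert φ T)) : Der act T (neg φ) := by
  simp only [Con, not_exists, not_not] at h
  refine (h (neg φ)).deduction.of_valuation fun v hv => ?_
  simp only [hv.imp, hv.neg]; tauto

theorem Der.of_not_con (h : ¬ Con act (insert (neg φ) T)) : Der act T φ := by
  refine (Der.neg_of_not_con h).of_valuation fun v hv => ?_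
  simp only [hv.neg]; tauto

/-- Countably many requests can be met by an increasing sequence of consistent sets. -/
theorem exists_chain {F : Type u} {C : Set F → Prop} {Q : ℕ → Set F}
    (hQ : ∀ n T, C T → ∃ φ ∈ Q n, C (insert φ T)) {T : Set F} (hT : C T) :
    ∃ U : ℕ → Set F, Monotone U ∧ U 0 = T ∧ (∀ n, C (U n)) ∧ ∀ n, ∃ φ ∈ Q n, φ ∈ U (n + 1) := by
  choose f hf hC using hQ
  let U : ℕ → {T // C T} := fun n =>
    Nat.rec ⟨T, hT⟩ (fun n V => ⟨insert (f n V.1 V.2) V.1, hC n V.1 V.2⟩) n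
  refine ⟨fun n => (U n).1, monotone_nat_of_le_succ fun n => Set.subset_insert _ _, rfl,
    fun n => (U n).2, fun n => ⟨_, hf n _ (U n).2, Set.mem_insert _ _⟩⟩

theorem countable_infRule [Countable Letter] :
    {p : Set (Formula m Letter) × Formula m Letter | InfRule p.1 p.2}.Countable := by
  refine ((((Set.countable_range fun q : Formula m Letter × Formula m Letter =>
      ((Set.range fun i : ℕ => neg (tilStep q.1 q.2 i)), neg (til q.1 q.2))).union
    (Set.countable_range fun q : Formula m Letter × Formula m Letter =>
      ((Set.range fun i : ℕ => neg (sinceStep q.1 q.2 i)), neg (since q.1 q.2)))).union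
    (Set.countable_range fun α : Formula m Letter =>
      ((Set.range fun i : ℕ => Formula.everyone^[i] α), common α))).union
    (Set.countable_range fun q : ProbIdx m × Formula m Letter × UnitQ =>
      ({φ | ∃ (i : ℕ) (s : UnitQ), 1 / (q.2.2 : ℚ) ≤ i ∧ (s : ℚ) = q.2.2 - 1 / i ∧
        φ = prob q.1 s q.2.1}, prob q.1 q.2.2 q.2.1))).mono ?_
  rintro ⟨S, τ⟩ h
  change InfRule S τ at h
  cases h with
  | til α β => exact .inl (.inl (.inl ⟨(α, β), rfl⟩))
  | since α β => exact .inl (.inl (.inr ⟨(α, β), rfl⟩))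
  | common α => exact .inl (.inr ⟨α, rfl⟩)
  | archimedean o α r hr => exact .inr ⟨(o, α, r), rfl⟩

/-- Lindenbaum's lemma. Only the stages of the chain are known to be consistent, so closure of the
union under infinitary rules must be arranged along the way, by treating each rule instance as a
request. -/
theorem Con.exists_mcs [Countable Letter] (hT : Con act T) : ∃ Γ, MCS act Γ ∧ T ⊆ Γ := by
  let I := {p : Set (Formula m Letter) × Formula m Letter // InfRule p.1 p.2}
  have : Countable I := countable_infRule.to_subtype
  let R := Formula m Letter ⊕ (Formula m Letter × List (Formula m Letter × Op m) × I)
  let Q : R → Set (Formula m Letter) := fun r => match r with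
    | .inl φ => {φ, neg φ}
    | .inr (β₀, L, p) => insert (nested β₀ L p.1.2) ((fun σ => neg (nested β₀ L σ)) '' p.1.1)
  have : Nonempty R := let ⟨φ, _⟩ := hT; ⟨.inl φ⟩
  obtain ⟨e, he⟩ := exists_surjective_nat R
  obtain ⟨U, hmono, rfl, hcon, hU⟩ := exists_chain (C := Con act) (Q := fun n => Q (e n))
    (by
      intro n T hT
      rcases e n with φ | ⟨β₀, L, ⟨⟨S, τ⟩, h⟩⟩
      · by_contra! hne
        exact hT.neg_not_der (Der.of_not_con (hne (neg φ) (.inr rfl)))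
          (Der.neg_of_not_con (hne φ (.inl rfl)))
      -- If no choice is consistent, every premise is derivable, hence so is the conclusion; but its
      -- negation is derivable too.
      · by_contra! hne
        refine hT.neg_not_der (Der.infRule h β₀ L fun σ hσ => ?_)
          (Der.neg_of_not_con (hne (nested β₀ L τ) (.inl rfl)))
        exact Der.of_not_con (hne _ (.inr ⟨σ, hσ, rfl⟩))) hT
  have hQ : ∀ r, ∃ φ ∈ Q r, φ ∈ ⋃ n, U n := fun r => by
    obtain ⟨n, rfl⟩ := he r
    obtain ⟨φ, h₁, h₂⟩ := hU n
    exact ⟨φ, h₁, Set.mem_iUnion.2 ⟨_, h₂⟩⟩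
  have hcomp : ∀ φ, φ ∈ ⋃ n, U n ∨ neg φ ∈ ⋃ n, U n := fun φ => by
    obtain ⟨ψ, rfl | rfl, h⟩ := hQ (.inl φ)
    · exact .inl h
    · exact .inr h
  have hneg : ∀ φ, φ ∈ ⋃ n, U n → neg φ ∉ ⋃ n, U n := by
    intro φ h₁ h₂
    obtain ⟨i, hi⟩ := Set.mem_iUnion.1 h₁
    obtain ⟨j, hj⟩ := Set.mem_iUnion.1 h₂
    exact (hcon (max i j)).neg_not_der (.hyp (hmono (le_max_left i j) hi))
      (.hyp (hmono (le_max_right i j) hj))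
  refine ⟨⋃ n, U n, ⟨fun {φ} h => ?_, fun φ => ⟨fun h h' => hneg φ h' h, (hcomp φ).resolve_left⟩⟩,
    Set.subset_iUnion U 0⟩
  -- Theorems and modus ponens involve finitely many formulas, which appear at a common stage;
  -- infinitary rules are covered by their requests.
  refine Der.induct (P := fun φ => φ ∈ ⋃ n, U n) ?_ (fun _ => id) ?_ ?_ h
  · intro α h
    refine (hcomp α).resolve_right fun h' => ?_
    obtain ⟨i, hi⟩ := Set.mem_iUnion.1 h'
    exact (hcon i).neg_not_der (.thm h) (.hyp hi)
  · intro α β h₁ h₂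
    refine (hcomp β).resolve_right fun h₃ => ?_
    obtain ⟨i, hi⟩ := Set.mem_iUnion.1 h₁
    obtain ⟨j, hj⟩ := Set.mem_iUnion.1 h₂
    obtain ⟨k, hk⟩ := Set.mem_iUnion.1 h₃
    refine (hcon (max i (max j k))).neg_not_der (φ := β) (Der.mp (α := α) (.hyp ?_) (.hyp ?_))
      (.hyp ?_)
    · exact hmono (by omega) hi
    · exact hmono (by omega) hj
    · exact hmono (by omega) hk
  · intro β₀ L S τ h hS
    obtain ⟨φ, rfl | ⟨σ, hσ, rfl⟩, h'⟩ := hQ (.inr (β₀, L, ⟨(S, τ), h⟩))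
    · exact h'
    · exact absurd h' (hneg _ (hS σ hσ))

theorem Der.of_forall_mcs [Countable Letter] (h : ∀ Γ, MCS act Γ → T ⊆ Γ → φ ∈ Γ) :
    Der act T φ := by
  refine Der.of_not_con fun hcon => ?_
  obtain ⟨Γ, hΓ, hT⟩ := hcon.exists_mcs
  exact (hΓ.neg_mem φ).1 (hT (Set.mem_insert _ _))
    (h Γ hΓ ((Set.subset_insert _ _).trans hT))

theorem Thm.of_forall_mcs [Countable Letter] (h : ∀ Γ, MCS act Γ → φ ∈ Γ) : Thm act φ :=
  (Der.of_forall_mcs (T := ∅) fun Γ hΓ _ => h Γ hΓ).thm_of_empty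

namespace MCS

variable (hΓ : MCS act Γ)
include hΓ

theorem thm (h : Thm act φ) : φ ∈ Γ := hΓ.closed (.thm h)

theorem ax (h : IsAxiom act φ) : φ ∈ Γ := hΓ.thm (.ax h)

theorem isValuation : IsValuation (· ∈ Γ) := by
  refine ⟨hΓ.neg_mem, fun α β => ⟨fun h => ⟨?_, ?_⟩, fun h => ?_⟩⟩
  · exact hΓ.closed ((Der.hyp h).of_valuation fun v hv h => ((hv.and _ _).1 h).1)
  · exact hΓ.closed ((Der.hyp h).of_valuation fun v hv h => ((hv.and _ _).1 h).2)
  · exact hΓ.closed ((Der.hyp h.1).of_valuation₂ (.hyp h.2) fun v hv h h' =>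
      (hv.and _ _).2 ⟨h, h'⟩)

theorem mp (h : imp α β ∈ Γ) (hα : α ∈ Γ) : β ∈ Γ := (hΓ.isValuation.imp _ _).1 h hα

theorem ax_mp (h : IsAxiom act (imp α β)) (hα : α ∈ Γ) : β ∈ Γ := hΓ.mp (hΓ.ax h) hα

theorem ax_iff (h : IsAxiom act (iff α β)) : α ∈ Γ ↔ β ∈ Γ :=
  (hΓ.isValuation.iff _ _).1 (hΓ.ax h)

theorem infRule {S : Set (Formula m Letter)} (h : InfRule S φ) (hS : S ⊆ Γ) : φ ∈ Γ :=
  hΓ.closed (Der.infRule' h fun _ hσ => .hyp (hS hσ))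

theorem op_der (X : Op m) (h : Der act {β | X.app β ∈ Γ} φ) : X.app φ ∈ Γ :=
  hΓ.closed ((h.op X).mono (by rintro _ ⟨β, hβ, rfl⟩; exact hβ))

/-- The existence lemma in contrapositive form, from strong necessitation and Lindenbaum's lemma. -/
theorem op_mem_of_forall [Countable Letter] (X : Op m)
    (h : ∀ Δ, MCS act Δ → {β | X.app β ∈ Γ} ⊆ Δ → φ ∈ Δ) : X.app φ ∈ Γ :=
  hΓ.op_der X (Der.of_forall_mcs h)

end MCS

end MCS

/-! ### Temporal structure of maximal consistent sets -/

section Time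

variable {m : ℕ} {Letter : Type u} {act : Fin m → Letter}
  {T Γ Δ : Set (Formula m Letter)} {α β φ ψ : Formula m Letter}

/-- The formulas that hold in the next state. -/
def nextSet (Γ : Set (Formula m Letter)) : Set (Formula m Letter) := {φ | next φ ∈ Γ}

/-- The formulas that hold in the previous state. -/
def prevSet (Γ : Set (Formula m Letter)) : Set (Formula m Letter) := {φ | prev φ ∈ Γ}

/-- A set of formulas describes an initial state if it contains all formulas `● φ`. -/
def IsStart (Γ : Set (Formula m Letter)) : Prop := ∀ φ, prev φ ∈ Γ

namespace MCS

variable (hΓ : MCS act Γ)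
include hΓ

theorem nextSet : MCS act (nextSet Γ) where
  closed h := hΓ.op_der .next h
  neg_mem φ := (hΓ.ax_iff (.next_neg φ)).symm.trans (hΓ.neg_mem _)

theorem prev_contra_mem (α : Formula m Letter) : prev (contra α) ∈ Γ ↔ IsStart Γ := by
  refine ⟨fun h φ => hΓ.op_der .prev ?_, fun h => h _⟩
  exact (Der.hyp (α := contra α) h).of_valuation fun v hv h => (hv.contra α h).elim

theorem prevSet (h : ¬ IsStart Γ) : MCS act (prevSet Γ) where
  closed h := hΓ.op_der .prev h
  neg_mem φ := by
    refine ⟨fun h₁ h₂ => h ?_, fun h₁ => ?_⟩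
    -- If both `φ` and its negation held previously, so would a contradiction, which happens only at
    -- an initial state.
    · exact (hΓ.prev_contra_mem φ).1
        (hΓ.ax_mp (.prev_and _ _) ((hΓ.isValuation.and _ _).2 ⟨h₂, h₁⟩))
    · by_contra h₂
      exact h₁ (hΓ.ax_mp (.prev_neg φ) ((hΓ.neg_mem _).2 h₂))

/-- Away from an initial state `●○` may be exchanged for `○●`, and `○●φ` is equivalent to `φ`. -/
theorem nextSet_prevSet (h : ¬ IsStart Γ) : PTEL.nextSet (PTEL.prevSet Γ) = Γ := by
  ext φ
  have h₁ := hΓ.ax_mp (.next_prev_comm₂ φ φ)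
    ((hΓ.neg_mem _).2 ((hΓ.prev_contra_mem φ).not.2 h))
  exact ((hΓ.isValuation.iff _ _).1 h₁).symm.trans (hΓ.ax_iff (.next_prev φ))

end MCS

/-- The runs of the canonical model. -/
abbrev StartSet (act : Fin m → Letter) : Type u :=
  {Γ : Set (Formula m Letter) // MCS act Γ ∧ IsStart Γ}

/-- The maximal consistent set of a world of the canonical model. -/
def state (w : StartSet act × ℕ) : Set (Formula m Letter) := nextSet^[w.2] w.1.1

theorem state_succ (r : StartSet act) (n : ℕ) : state (r, n + 1) = nextSet (state (r, n)) :=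
  Function.iterate_succ_apply' _ _ _

theorem state_mcs : ∀ w : StartSet act × ℕ, MCS act (state w)
  | (r, 0) => r.2.1
  | (r, n + 1) => by rw [state_succ]; exact (state_mcs (r, n)).nextSet

theorem mem_state_add (r : StartSet act) (n : ℕ) (φ : Formula m Letter) (l : ℕ) :
    φ ∈ state (r, n + l) ↔ next^[l] φ ∈ state (r, n) := by
  induction l generalizing φ with
  | zero => rfl
  | succ l ih => rw [← add_assoc, state_succ, Function.iterate_succ_apply, ← ih]; rfl

theorem prev_mem_state_zero (r : StartSet act) (φ : Formula m Letter) :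
    prev φ ∈ state (r, 0) := r.2.2 φ

theorem prev_mem_state_succ (r : StartSet act) (n : ℕ) (φ : Formula m Letter) :
    prev φ ∈ state (r, n + 1) ↔ φ ∈ state (r, n) := by
  rw [state_succ]
  exact (state_mcs (r, n)).ax_iff (.next_prev φ)

theorem iterate_prev_mem_state (r : StartSet act) (φ : Formula m Letter) (l n : ℕ) :
    prev^[l] φ ∈ state (r, n) ↔ (l ≤ n → φ ∈ state (r, n - l)) := by
  induction l generalizing n with
  | zero => simp
  | succ l ih =>
    rw [Function.iterate_succ_apply']
    rcases n with _ | n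
    · simp [prev_mem_state_zero]
    · rw [prev_mem_state_succ, ih]
      simp

/-- Step back `i` times: `h₁` keeps each set left behind from being initial, so the step can be
undone by `nextSet`, and `h₂` says that the last set reached is initial. -/
theorem exists_state_of_iterate_prev {i : ℕ} (hΓ : MCS act Γ)
    (h₁ : ∀ l ≤ i, prev^[l] (contra α) ∉ Γ) (h₂ : prev^[i] (prev (contra β)) ∈ Γ) :
    ∃ w : StartSet act × ℕ, state w = Γ := by
  induction i generalizing Γ with
  | zero => exact ⟨(⟨Γ, hΓ, (hΓ.prev_contra_mem β).1 h₂⟩, 0), rfl⟩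
  | succ i ih =>
    have hs : ¬ IsStart Γ := (hΓ.prev_contra_mem α).not.1 (h₁ 1 (by omega))
    obtain ⟨⟨r, n⟩, hw⟩ := ih (hΓ.prevSet hs)
      (fun l hl h => h₁ (l + 1) (by omega) (by rw [Function.iterate_succ_apply']; exact h))
      (by rw [Function.iterate_succ_apply'] at h₂; exact h₂)
    exact ⟨(r, n + 1), by rw [state_succ, hw, hΓ.nextSet_prevSet hs]⟩

/-- Otherwise `Γ` contains every premise of the infinitary rule for `til`, hence the negation of
`til α β`. -/
theorem MCS.exists_tilStep_mem (hΓ : MCS act Γ) (h : til α β ∈ Γ) :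
    ∃ i, (∀ l < i, next^[l] α ∈ Γ) ∧ next^[i] β ∈ Γ := by
  by_contra! hne
  refine (hΓ.neg_mem _).1 (hΓ.infRule (.til α β) ?_) h
  rintro _ ⟨i, rfl⟩
  refine (hΓ.neg_mem _).2 fun hi => ?_
  obtain ⟨h₁, h₂⟩ := (hΓ.isValuation.tilStep α β i).1 hi
  exact hne i h₁ h₂

theorem MCS.exists_sinceStep_mem (hΓ : MCS act Γ) (h : since α β ∈ Γ) :
    ∃ i, (∀ l < i, prev^[l] α ∈ Γ) ∧ (∀ l ≤ i, prev^[l] (contra α) ∉ Γ) ∧ prev^[i] β ∈ Γ := by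
  by_contra! hne
  refine (hΓ.neg_mem _).1 (hΓ.infRule (.since α β) ?_) h
  rintro _ ⟨i, rfl⟩
  refine (hΓ.neg_mem _).2 fun hi => ?_
  obtain ⟨h₁, h₂, h₃⟩ := (hΓ.isValuation.sinceStep α β i).1 hi
  exact hne i h₁ h₂ h₃

/-- Every maximal consistent set belongs to a world of the canonical model. -/
theorem MCS.exists_state [Nonempty Letter] (hΓ : MCS act Γ) :
    ∃ w : StartSet act × ℕ, state w = Γ := by
  inhabit Letter
  -- Once `●⊥`: an initial state occurs finitely many steps in the past.
  obtain ⟨i, -, h₁, h₂⟩ := hΓ.exists_sinceStep_mem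
    (hΓ.ax (.once_prev (contra (letter (default : Letter)))))
  exact exists_state_of_iterate_prev hΓ h₁ h₂

theorem til_mem_state (r : StartSet act) (n : ℕ) :
    til α β ∈ state (r, n) ↔
      ∃ j, n ≤ j ∧ β ∈ state (r, j) ∧ ∀ k, n ≤ k → k < j → α ∈ state (r, k) := by
  constructor
  · intro h
    obtain ⟨i, h₁, h₂⟩ := (state_mcs (r, n)).exists_tilStep_mem h
    refine ⟨n + i, by omega, (mem_state_add r n β i).2 h₂, fun k hk hk' => ?_⟩
    obtain ⟨l, rfl⟩ := Nat.exists_eq_add_of_le hk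
    exact (mem_state_add r n α l).2 (h₁ l (by omega))
  · rintro ⟨j, hj, hβ, hα⟩
    obtain ⟨i, rfl⟩ := Nat.exists_eq_add_of_le hj
    induction i generalizing n with
    | zero =>
      have hv := (state_mcs (r, n)).isValuation
      exact ((state_mcs (r, n)).ax_iff (.til_next α β)).2 ((hv.or _ _).2 (.inl hβ))
    | succ i ih =>
      have hv := (state_mcs (r, n)).isValuation
      refine ((state_mcs (r, n)).ax_iff (.til_next α β)).2 ((hv.or _ _).2 (.inr ?_))
      refine (hv.and _ _).2 ⟨hα n le_rfl (by omega), ?_⟩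
      have := ih (n + 1) (by omega) (by rwa [add_right_comm]) fun k hk hk' =>
        hα k (by omega) (by omega)
      rwa [state_succ] at this

theorem since_mem_state (r : StartSet act) (n : ℕ) :
    since α β ∈ state (r, n) ↔
      ∃ j, j ≤ n ∧ β ∈ state (r, j) ∧ ∀ k, j < k → k ≤ n → α ∈ state (r, k) := by
  constructor
  · intro h
    obtain ⟨i, h₁, h₂, h₃⟩ := (state_mcs (r, n)).exists_sinceStep_mem h
    -- Beyond the beginning of the run every `●^i` formula holds vacuously, even that of a
    -- contradiction, which `h₂` excludes.
    have hi : i ≤ n := by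
      by_contra hlt
      exact h₂ i le_rfl ((iterate_prev_mem_state r _ i n).2 fun h => absurd h hlt)
    refine ⟨n - i, by omega, (iterate_prev_mem_state r β i n).1 h₃ hi, fun k hk hk' => ?_⟩
    have := (iterate_prev_mem_state r α (n - k) n).1 (h₁ (n - k) (by omega)) (by omega)
    rwa [Nat.sub_sub_self hk'] at this
  · rintro ⟨j, hj, hβ, hα⟩
    induction n, hj using Nat.le_induction with
    | base =>
      have hv := (state_mcs (r, j)).isValuation
      exact ((state_mcs (r, j)).ax_iff (.since_prev α β)).2 ((hv.or _ _).2 (.inl hβ))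
    | succ n hn ih =>
      have hv := (state_mcs (r, n + 1)).isValuation
      refine ((state_mcs (r, n + 1)).ax_iff (.since_prev α β)).2 ((hv.or _ _).2 (.inr ?_))
      refine (hv.and _ _).2 ⟨(hv.neg _).2 ?_, (hv.and _ _).2
        ⟨hα _ (by omega) le_rfl, (prev_mem_state_succ r n _).2 (ih fun k hk hk' =>
          hα k hk (by omega))⟩⟩
      rw [prev_mem_state_succ]
      exact (state_mcs (r, n)).isValuation.contra α

end Time

/-! ### Knowledge -/

section Knowledge

variable {m : ℕ} {Letter : Type u} {act : Fin m → Letter} {φ : Formula m Letter}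

/-- Accessibility in the canonical model. -/
def stateAcc (a : Fin m) (w w' : StartSet act × ℕ) : Prop :=
  ∀ β, know a β ∈ state w → β ∈ state w'

/-- The set provided by the existence lemma is automatically a world, since every maximal consistent
set is a state. -/
theorem know_mem_state [Nonempty Letter] [Countable Letter] (a : Fin m)
    (w : StartSet act × ℕ) : know a φ ∈ state w ↔ ∀ w', stateAcc a w w' → φ ∈ state w' := by
  refine ⟨fun h w' hw => hw φ h, fun h => (state_mcs w).op_mem_of_forall (.know a) ?_⟩
  intro Δ hΔ hsub
  obtain ⟨w', rfl⟩ := hΔ.exists_state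
  exact h w' hsub

theorem stateAcc_symm {a : Fin m} {w w' : StartSet act × ℕ} (h : stateAcc a w w') :
    stateAcc a w' w := by
  intro β hβ
  by_contra hne
  have h₁ := h _ ((state_mcs w).ax_mp (.know_symm a β) (((state_mcs w).neg_mem _).2 hne))
  exact ((state_mcs w').neg_mem _).1 h₁ hβ

theorem stateAcc_trans {a : Fin m} {w w' w'' : StartSet act × ℕ} (h : stateAcc a w w')
    (h' : stateAcc a w' w'') : stateAcc a w w'' := fun β hβ =>
  h' β (h _ ((state_mcs w).ax_mp (.know_trans a β) hβ))

theorem stateAcc_refl {a : Fin m} {w : StartSet act × ℕ} (h : letter (act a) ∈ state w) :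
    stateAcc a w w := fun β hβ =>
  (state_mcs w).mp ((state_mcs w).ax_mp (.know_refl a β) h) hβ

theorem not_stateAcc {a : Fin m} {w : StartSet act × ℕ} (h : letter (act a) ∉ state w)
    (w' : StartSet act × ℕ) : ¬ stateAcc a w w' := fun hw =>
  (state_mcs w').isValuation.contra (letter (act a)) <| hw _ <|
    (state_mcs w).ax_mp (.know_dead a _) (((state_mcs w).neg_mem _).2 h)

theorem common_mem_state (w : StartSet act × ℕ) :
    common φ ∈ state w ↔ ∀ k : ℕ, Formula.everyone^[k] φ ∈ state w := by
  refine ⟨fun h k => (state_mcs w).ax_mp (.common_everyone φ k) h, fun h => ?_⟩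
  refine (state_mcs w).infRule (.common φ) ?_
  rintro _ ⟨k, rfl⟩
  exact h k

end Knowledge

/-! ### Probability in maximal consistent sets -/

section Probability

variable {m : ℕ} {Letter : Type u} {act : Fin m → Letter}
  {Γ : Set (Formula m Letter)} {o : ProbIdx m} {α β γ φ : Formula m Letter} {s t : UnitQ}

theorem UnitQ.compl_compl (s : UnitQ) : s.compl.compl = s := Subtype.ext (by simp [UnitQ.compl])

/-- The probability of a formula according to a set of formulas. -/
noncomputable def probSup (Γ : Set (Formula m Letter)) (o : ProbIdx m) (α : Formula m Letter) :
    ℝ :=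
  sSup ((fun s : UnitQ => ((s : ℚ) : ℝ)) '' {s | prob o s α ∈ Γ})

namespace MCS

variable (hΓ : MCS act Γ)
include hΓ

theorem prob_one_of_thm (h : Thm act α) : prob o 1 α ∈ Γ :=
  hΓ.thm (.nec (.prob o α 1 rfl) (by rintro _ rfl; exact h))

theorem prob_add (h₁ : prob o s α ∈ Γ) (h₂ : prob o t β ∈ Γ)
    (h : prob o 1 (neg (and α β)) ∈ Γ) {u : UnitQ} (hu : (u : ℚ) = min 1 ((s : ℚ) + t)) :
    prob o u (or α β) ∈ Γ := by
  have hv := hΓ.isValuation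
  exact hΓ.ax_mp (.prob_add o α β s t 1 u rfl hu) ((hv.and _ _).2 ⟨(hv.and _ _).2 ⟨h₁, h₂⟩, h⟩)

theorem prob_neg_of_notMem (h : prob o t α ∉ Γ) : prob o t.compl (neg α) ∈ Γ :=
  hΓ.ax_mp (.prob_lt_le o α t) ((hΓ.neg_mem _).2 h)

theorem notMem_of_prob_neg (h : prob o s.compl (neg α) ∈ Γ) (hst : s < t) : prob o t α ∉ Γ :=
  (hΓ.neg_mem _).1 (hΓ.ax_mp (.prob_le_lt o α s t hst) h)

theorem prob_subadd (h₁ : prob o s.compl (neg α) ∈ Γ) (h₂ : prob o t β ∉ Γ) {u : UnitQ}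
    (hu : (u : ℚ) = s + t) : prob o u (or α β) ∉ Γ :=
  (hΓ.neg_mem _).1 (hΓ.ax_mp (.prob_subadd o α β s t u hu)
    ((hΓ.isValuation.and _ _).2 ⟨h₁, (hΓ.neg_mem _).2 h₂⟩))

/-- Monotonicity is not an axiom; this extracts it from subadditivity. If `γ` had probability below
`s` while the negation of `α` has at most `1 - s`, their disjunction would have probability below 1.
Padding `α` with a contradiction makes `or α (contra α)` literally a negation, so no congruence
under `prob` is needed yet. -/
theorem prob_of_prob_one_or
    (h : prob o 1 (or (and (neg α) (neg (contra α))) γ) ∈ Γ) (hα : prob o s α ∈ Γ) :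
    prob o s γ ∈ Γ := by
  by_contra hγ
  have h₁ : prob o s (or α (contra α)) ∈ Γ :=
    hΓ.prob_add hα (hΓ.ax (.prob_zero o (contra α) 0 rfl))
      (hΓ.prob_one_of_thm (.of_valuation fun v hv =>
        (hv.neg _).2 fun h => hv.contra α ((hv.and _ _).1 h).2))
      (by have := s.2.2; simp [this])
  rw [← s.compl_compl] at h₁
  exact hΓ.prob_subadd (u := 1) h₁ hγ (by simp [UnitQ.compl]) h

theorem prob_of_thm_imp (h : Thm act (imp α γ)) (hα : prob o s α ∈ Γ) : prob o s γ ∈ Γ := by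
  refine hΓ.prob_of_prob_one_or (hΓ.prob_one_of_thm (h.mp (.of_valuation fun v hv => ?_))) hα
  have := hv.contra α
  simp only [hv.imp, hv.or, hv.and, hv.neg]; tauto

theorem prob_of_prob_one_imp (h : prob o 1 (imp α γ) ∈ Γ) (hα : prob o s α ∈ Γ) :
    prob o s γ ∈ Γ := by
  refine hΓ.prob_of_prob_one_or (hΓ.prob_of_thm_imp (.of_valuation fun v hv => ?_) h) hα
  have := hv.contra α
  simp only [hv.imp, hv.or, hv.and, hv.neg]; tauto

theorem prob_anti (hst : s ≤ t) (h : prob o t α ∈ Γ) : prob o s α ∈ Γ := by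
  rcases hst.eq_or_lt with rfl | hlt
  · exact h
  · by_contra hs
    exact hΓ.notMem_of_prob_neg (hΓ.prob_neg_of_notMem hs) hlt h

omit hΓ in
theorem _root_.PTEL.bddAbove_prob :
    BddAbove ((fun s : UnitQ => ((s : ℚ) : ℝ)) '' {s | prob o s α ∈ Γ}) := by
  refine ⟨1, ?_⟩
  rintro _ ⟨s, -, rfl⟩
  exact (by exact_mod_cast s.2.2 : ((s : ℚ) : ℝ) ≤ 1)

theorem prob_nonempty (o : ProbIdx m) (α : Formula m Letter) :
    ((fun s : UnitQ => ((s : ℚ) : ℝ)) '' {s | prob o s α ∈ Γ}).Nonempty :=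
  Set.Nonempty.image _ ⟨0, hΓ.ax (.prob_zero o α 0 rfl)⟩

/-- Each `s - 1/i` lies strictly below the supremum, hence below some `q` with `prob o q α ∈ Γ`; the
Archimedean rule then reaches `s`. The rule requires `s > 0`, so `s = 0` falls to an axiom. -/
theorem le_probSup_iff : ((s : ℚ) : ℝ) ≤ probSup Γ o α ↔ prob o s α ∈ Γ := by
  refine ⟨fun h => ?_, fun h => le_csSup bddAbove_prob ⟨s, h, rfl⟩⟩
  rcases s.2.1.eq_or_lt with h0 | hpos
  · exact hΓ.ax (.prob_zero o α s h0.symm)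
  refine hΓ.infRule (.archimedean o α s hpos) ?_
  rintro _ ⟨i, t, hi, ht, rfl⟩
  have hi' : (0 : ℚ) < i := (one_div_pos.2 hpos).trans_le hi
  have hts : (t : ℚ) < s := by rw [ht]; exact sub_lt_self _ (one_div_pos.2 hi')
  have hlt : ((t : ℚ) : ℝ) < probSup Γ o α := lt_of_lt_of_le (by exact_mod_cast hts) h
  obtain ⟨_, ⟨q, hq, rfl⟩, htq⟩ := exists_lt_of_lt_csSup (hΓ.prob_nonempty o α) hlt
  exact hΓ.prob_anti (show t ≤ q from Subtype.coe_le_coe.1 (Rat.cast_le.1 htq.le)) hq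

theorem probSup_mem_Icc : probSup Γ o α ∈ Set.Icc (0 : ℝ) 1 := by
  refine ⟨?_, csSup_le (hΓ.prob_nonempty o α) ?_⟩
  · have := (hΓ.le_probSup_iff (s := 0)).2 (hΓ.ax (.prob_zero o α 0 rfl))
    simpa using this
  · rintro _ ⟨s, -, rfl⟩
    exact (by exact_mod_cast s.2.2 : ((s : ℚ) : ℝ) ≤ 1)

theorem probSup_eq_one (h : prob o 1 α ∈ Γ) : probSup Γ o α = 1 := by
  refine le_antisymm hΓ.probSup_mem_Icc.2 ?_
  have := hΓ.le_probSup_iff.2 h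
  simpa using this

theorem probSup_le_probSup (h : prob o 1 (imp α β) ∈ Γ) : probSup Γ o α ≤ probSup Γ o β := by
  refine csSup_le (hΓ.prob_nonempty o α) ?_
  rintro _ ⟨s, hs, rfl⟩
  exact hΓ.le_probSup_iff.2 (hΓ.prob_of_prob_one_imp h hs)

theorem probSup_congr (h : prob o 1 (iff α β) ∈ Γ) : probSup Γ o α = probSup Γ o β := by
  refine le_antisymm (hΓ.probSup_le_probSup (hΓ.prob_of_thm_imp (.of_valuation fun v hv => ?_) h))
    (hΓ.probSup_le_probSup (hΓ.prob_of_thm_imp (.of_valuation fun v hv => ?_) h))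
  all_goals simp only [hv.imp, hv.iff]; tauto

theorem probSup_or (h : prob o 1 (neg (and α β)) ∈ Γ) :
    probSup Γ o (or α β) = probSup Γ o α + probSup Γ o β := by
  apply le_antisymm
  · by_contra! hlt
    -- Rationals `r` and `t` above the two probabilities, with sum still below that of the
    -- disjunction, contradict subadditivity.
    obtain ⟨r, hr, hr'⟩ := exists_rat_btwn (show probSup Γ o α <
      probSup Γ o (or α β) - probSup Γ o β by linarith)
    obtain ⟨t, ht, ht'⟩ := exists_rat_btwn (show probSup Γ o β <
      probSup Γ o (or α β) - r by linarith)
    have hα := (hΓ.probSup_mem_Icc (o := o) (α := α)).1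
    have hβ := (hΓ.probSup_mem_Icc (o := o) (α := β)).1
    have h1 := (hΓ.probSup_mem_Icc (o := o) (α := .or α β)).2
    have hr0 : 0 ≤ r := by exact_mod_cast hα.trans hr.le
    have ht0 : 0 ≤ t := by exact_mod_cast hβ.trans ht.le
    have hrt : r + t ≤ 1 := by
      have : (r : ℝ) + t ≤ 1 := by linarith
      exact_mod_cast this
    let r' : UnitQ := ⟨r, hr0, by linarith⟩
    let t' : UnitQ := ⟨t, ht0, by linarith⟩
    let u : UnitQ := ⟨r + t, by linarith, hrt⟩
    have hr₁ : prob o r' α ∉ Γ := fun h => not_le.2 hr (hΓ.le_probSup_iff.2 h)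
    have ht₁ : prob o t' β ∉ Γ := fun h => not_le.2 ht (hΓ.le_probSup_iff.2 h)
    refine hΓ.prob_subadd (u := u) (hΓ.prob_neg_of_notMem hr₁) ht₁ rfl (hΓ.le_probSup_iff.1 ?_)
    simp only [u]
    push_cast
    linarith
  · have key : ∀ s t : UnitQ, prob o s α ∈ Γ → prob o t β ∈ Γ →
        ((s : ℚ) : ℝ) + ((t : ℚ) : ℝ) ≤ probSup Γ o (or α β) := by
      intro s t hs ht
      -- Rules out truncation by `min 1`: disjointness bounds the probability of `β` by `1 - s`, so
      -- `t` cannot exceed that.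
      have hle : (s : ℚ) + t ≤ 1 := by
        by_contra! hlt
        have h₁ : prob o s (neg β) ∈ Γ := by
          refine hΓ.prob_of_prob_one_imp (hΓ.prob_of_thm_imp (.of_valuation fun v hv => ?_) h) hs
          simp only [hv.imp, hv.neg, hv.and]; tauto
        rw [← s.compl_compl] at h₁
        refine hΓ.notMem_of_prob_neg h₁ (Subtype.coe_lt_coe.1 ?_) ht
        simp only [UnitQ.compl]
        linarith
      let u : UnitQ := ⟨s + t, add_nonneg s.2.1 t.2.1, hle⟩
      have := hΓ.le_probSup_iff.2 (hΓ.prob_add hs ht h (u := u) (by simp [u, hle]))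
      simpa [u] using this
    rw [← le_sub_iff_add_le]
    refine csSup_le (hΓ.prob_nonempty o α) ?_
    rintro _ ⟨s, hs, rfl⟩
    rw [le_sub_comm]
    refine csSup_le (hΓ.prob_nonempty o β) ?_
    rintro _ ⟨t, ht, rfl⟩
    have := key s t hs ht
    simp only
    linarith

end MCS

open Classical in
/-- The finitely additive probability on the extensions of formulas given by a maximal consistent
set. -/
noncomputable def MCS.finAddProb [Nonempty Letter] (hΓ : MCS act Γ) (o : ProbIdx m) {X : Type u}
    (V : X → Formula m Letter → Prop) (hV : ∀ x, IsValuation (V x))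
    (h : ∀ α, (∀ x, V x α) → prob o 1 α ∈ Γ) : FinAddProb X :=
  -- The value depends only on the extension: formulas with equal extensions have a biconditional
  -- true at every point, which `h` turns into probability 1. This justifies choosing a defining
  -- formula in `μ`.
  have hcongr : ∀ α β, {x | V x α} = {x | V x β} → probSup Γ o α = probSup Γ o β :=
    fun α β hαβ => hΓ.probSup_congr (h _ fun x => ((hV x).iff α β).2 (Set.ext_iff.1 hαβ x))
  have hμ : ∀ α (hα : ∃ β, {x | V x β} = {x | V x α}),
      probSup Γ o hα.choose = probSup Γ o α := fun α hα => hcongr _ _ hα.choose_spec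
  have hor : ∀ α β, {x | V x α} ∪ {x | V x β} = {x | V x (or α β)} :=
    fun α β => Set.ext fun x => ((hV x).or α β).symm
  have huniv : ∀ α : Formula m Letter, Set.univ = {x | V x (neg (contra α))} :=
    fun α => (Set.eq_univ_of_forall fun x => ((hV x).neg _).2 ((hV x).contra α)).symm
  { alg := Set.range fun α => {x | V x α}
    isSetAlgebra :=
      { empty_mem := ⟨contra (letter (Classical.arbitrary Letter)),
          Set.eq_empty_of_forall_notMem fun x => (hV x).contra _⟩
        compl_mem := by
          rintro _ ⟨α, rfl⟩
          exact ⟨neg α, Set.ext fun x => (hV x).neg α⟩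
        union_mem := by
          rintro _ _ ⟨α, rfl⟩ ⟨β, rfl⟩
          exact ⟨or α β, (hor α β).symm⟩ }
    μ := fun A => if hA : ∃ α, {x | V x α} = A then probSup Γ o hA.choose else 0
    mem_unit := by
      rintro _ ⟨α, rfl⟩
      rw [dif_pos ⟨α, rfl⟩]
      exact hΓ.probSup_mem_Icc
    μ_univ := by
      rw [huniv (letter (Classical.arbitrary Letter)), dif_pos ⟨_, rfl⟩, hμ]
      exact hΓ.probSup_eq_one (h _ fun x => ((hV x).neg _).2 ((hV x).contra _))
    μ_union := by
      rintro _ ⟨α, rfl⟩ _ ⟨β, rfl⟩ hdisj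
      simp only [hor]
      rw [dif_pos ⟨_, rfl⟩, dif_pos ⟨_, rfl⟩, dif_pos ⟨_, rfl⟩, hμ, hμ, hμ]
      refine hΓ.probSup_or (h _ fun x => ((hV x).neg _).2 fun hx => ?_)
      exact Set.disjoint_left.1 hdisj ((hV x).and α β |>.1 hx).1 ((hV x).and α β |>.1 hx).2 }

theorem MCS.le_finAddProb_iff [Nonempty Letter] (hΓ : MCS act Γ) {X : Type u}
    {V : X → Formula m Letter → Prop} (hV : ∀ x, IsValuation (V x))
    (h : ∀ α, (∀ x, V x α) → prob o 1 α ∈ Γ) :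
    ((s : ℚ) : ℝ) ≤ (hΓ.finAddProb o V hV h).μ {x | V x α} ↔ prob o s α ∈ Γ := by
  have hex : ∃ β, {x | V x β} = {x | V x α} := ⟨α, rfl⟩
  have : (hΓ.finAddProb o V hV h).μ {x | V x α} = probSup Γ o α := by
    refine (dif_pos hex).trans ?_
    exact hΓ.probSup_congr (h _ fun x => ((hV x).iff _ _).2 (Set.ext_iff.1 hex.choose_spec x))
  rw [this, hΓ.le_probSup_iff]

/-- The initial maximal consistent sets are those containing `●⊥`, so `●⊥ → φ` is a theorem, and
`●⊥` has probability 1 on runs. -/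
theorem prob_run_of_forall_start [Countable Letter] (hΓ : MCS act Γ)
    (h : ∀ r : StartSet act, φ ∈ state (r, 0)) : prob .run 1 φ ∈ Γ := by
  refine hΓ.prob_of_prob_one_imp (α := prev (contra φ)) (hΓ.prob_one_of_thm ?_)
    (hΓ.ax (.prob_start φ 1 rfl))
  refine Thm.of_forall_mcs fun Δ hΔ => (hΔ.isValuation.imp _ _).2 fun hstart => ?_
  exact h ⟨Δ, hΔ, (hΔ.prev_contra_mem φ).1 hstart⟩

theorem prob_of_forall_state [Nonempty Letter] [Countable Letter] (hΓ : MCS act Γ)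
    (h : ∀ w : StartSet act × ℕ, φ ∈ state w) : prob o 1 φ ∈ Γ := by
  refine hΓ.prob_one_of_thm (Thm.of_forall_mcs fun Δ hΔ => ?_)
  obtain ⟨w, rfl⟩ := hΔ.exists_state
  exact h w

end Probability

/-! ### The canonical model -/

section Canonical

variable {m : ℕ} {Letter : Type u} [Nonempty Letter] [Countable Letter] {act : Fin m → Letter}

/-- The canonical model. -/
noncomputable def canonicalModel [Nonempty (StartSet act)] : Model act where
  Run := StartSet act
  nonempty_run := inferInstance
  val r n := {p | letter p ∈ state (r, n)}
  active w := {a | letter (act a) ∈ state w}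
  mem_active _ _ _ := Iff.rfl
  acc := stateAcc
  acc_symm _ _ _ := stateAcc_symm
  acc_trans _ _ _ _ := stateAcc_trans
  acc_dead _ _ := ⟨not_stateAcc, fun h h' => h _ (stateAcc_refl h')⟩
  acc_refl _ _ := stateAcc_refl
  runProb w := (state_mcs w).finAddProb .run (fun r α => α ∈ state (r, 0))
    (fun r => (state_mcs (r, 0)).isValuation) fun _ => prob_run_of_forall_start (state_mcs w)
  -- One sample space suffices: dependence on the agent and the world is carried by the measure
  -- alone.
  space _ _ := Set.univ
  nonempty_space _ w := ⟨w, trivial⟩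
  agentProb a w := (state_mcs w).finAddProb (.agent a) (fun w' α => α ∈ state w'.1)
    (fun w' => (state_mcs w'.1).isValuation) fun _ h =>
      prob_of_forall_state (state_mcs w) fun w' => h ⟨w', trivial⟩

variable [Nonempty (StartSet act)]

theorem everyone_canonicalModel (φ : Formula m Letter) (w : StartSet act × ℕ) :
    (canonicalModel (act := act)).everyone (fun w' => φ ∈ state w') w ↔ φ.everyone ∈ state w := by
  rw [(state_mcs w).isValuation.everyone]
  exact forall_congr' fun a => (know_mem_state a w).symm

theorem iterate_everyone_canonicalModel (φ : Formula m Letter) (k : ℕ) :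
    ((canonicalModel (act := act)).everyone^[k] fun w' => φ ∈ state w') =
      fun w : StartSet act × ℕ => Formula.everyone^[k] φ ∈ state w := by
  induction k with
  | zero => rfl
  | succ k ih =>
    rw [Function.iterate_succ_apply', Function.iterate_succ_apply', ih]
    exact funext fun w => propext (everyone_canonicalModel _ w)

/-- The truth lemma. -/
theorem sat_canonicalModel (φ : Formula m Letter) (w : StartSet act × ℕ) :
    (canonicalModel (act := act)).Sat w φ ↔ φ ∈ state w := by
  induction φ generalizing w with
  | letter p => exact Iff.rfl
  | neg φ ih => exact (ih w).not.trans ((state_mcs w).neg_mem φ).symm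
  | and φ ψ ih₁ ih₂ =>
    exact (and_congr (ih₁ w) (ih₂ w)).trans ((state_mcs w).isValuation.and φ ψ).symm
  | next φ ih =>
    obtain ⟨r, n⟩ := w
    exact (ih (r, n + 1)).trans (by rw [state_succ]; rfl)
  | til φ ψ ih₁ ih₂ =>
    obtain ⟨r, n⟩ := w
    simp only [til_mem_state, ← ih₁, ← ih₂]
    exact Iff.rfl
  | prev φ ih =>
    obtain ⟨r, _ | n⟩ := w
    · simp [Model.Sat, prev_mem_state_zero]
    · rw [prev_mem_state_succ, ← ih]
      simp only [Model.Sat, Nat.add_eq_zero_iff, one_ne_zero, and_false, false_or,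
        Nat.le_add_left, true_and]
      exact Iff.rfl
  | since φ ψ ih₁ ih₂ =>
    obtain ⟨r, n⟩ := w
    simp only [since_mem_state, ← ih₁, ← ih₂]
    exact Iff.rfl
  | know a φ ih =>
    rw [know_mem_state]
    exact forall_congr' fun w' => imp_congr_right fun _ => ih w'
  | common φ ih =>
    rw [common_mem_state]
    refine forall_congr' fun k => ?_
    have : (fun w' => (canonicalModel (act := act)).Sat w' φ) = fun w' => φ ∈ state w' :=
      funext fun w' => propext (ih w')
    exact iff_of_eq ((congrArg (fun f => ((canonicalModel (act := act)).everyone^[k] f) w) this).trans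
      (congrFun (iterate_everyone_canonicalModel φ k) w))
  | prob o s φ ih =>
    rcases o with _ | a
    · refine Iff.trans ?_ ((state_mcs w).le_finAddProb_iff (V := fun r α => α ∈ state (r, 0))
        (fun r => (state_mcs (r, 0)).isValuation) fun _ => prob_run_of_forall_start (state_mcs w))
      simp only [← ih]
      exact Iff.rfl
    · refine Iff.trans ?_ ((state_mcs w).le_finAddProb_iff (o := .agent a)
        (V := fun (w' : (Set.univ : Set (StartSet act × ℕ))) α => α ∈ state w'.1)
        (fun w' => (state_mcs w'.1).isValuation) fun _ h =>
          prob_of_forall_state (state_mcs w) fun w' => h ⟨w', trivial⟩)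
      simp only [← ih]
      exact Iff.rfl

theorem measurable_canonicalModel : (canonicalModel (act := act)).Measurable := fun _ β =>
  ⟨⟨β, Set.ext fun r => (sat_canonicalModel β (r, 0)).symm⟩,
    fun _ => ⟨β, Set.ext fun w' => (sat_canonicalModel β w'.1).symm⟩⟩

omit [Nonempty (StartSet act)] in
theorem Con.satisfiable {T : Set (Formula m Letter)} (hT : Con act T) : Satisfiable act T := by
  obtain ⟨Γ, hΓ, hsub⟩ := hT.exists_mcs
  obtain ⟨w, rfl⟩ := hΓ.exists_state
  have : Nonempty (StartSet act) := ⟨w.1⟩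
  exact ⟨canonicalModel, measurable_canonicalModel, w, fun α hα =>
    (sat_canonicalModel α w).2 (hsub hα)⟩

end Canonical

/-! ### Soundness -/

/-- Both `A ∪ B` and `B` split off the piece `B \ A`. The two additivity axioms rest on this
identity. -/
theorem FinAddProb.μ_union_add_inter {X : Type u} (p : FinAddProb X) {A B : Set X}
    (hA : A ∈ p.alg) (hB : B ∈ p.alg) : p.μ (A ∪ B) + p.μ (A ∩ B) = p.μ A + p.μ B := by
  have hi := p.isSetAlgebra.inter_mem hA hB
  have hd := p.isSetAlgebra.sdiff_mem hB hA
  have h₁ := p.μ_union A hA (B \ A) hd Set.disjoint_sdiff_right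
  have h₂ := p.μ_union (A ∩ B) hi (B \ A) hd
    (Set.disjoint_sdiff_right.mono_left Set.inter_subset_left)
  have h₃ : A ∩ B ∪ B \ A = B := by
    rw [Set.inter_comm]; exact Set.inter_union_sdiff B A
  rw [Set.union_sdiff_self] at h₁
  rw [h₃] at h₂
  linarith

theorem FinAddProb.μ_empty {X : Type u} (p : FinAddProb X) : p.μ ∅ = 0 := by
  have h := p.μ_union ∅ p.isSetAlgebra.empty_mem ∅ p.isSetAlgebra.empty_mem
    (Set.disjoint_empty _)
  rw [Set.union_empty] at h
  linarith

section Soundness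

variable {m : ℕ} {Letter : Type u} {act : Fin m → Letter}

namespace Model

variable (M : Model act)

theorem isValuation_sat (w : M.World) : IsValuation (M.Sat w) :=
  ⟨fun _ => Iff.rfl, fun _ _ => Iff.rfl⟩

/-- The probability of a formula in a world. -/
noncomputable def pr (o : ProbIdx m) (w : M.World) (β : Formula m Letter) : ℝ :=
  match o with
  | .run => (M.runProb w).μ {r | M.Sat (r, 0) β}
  | .agent a => (M.agentProb a w).μ {w' | M.Sat w'.1 β}

variable {M} {o : ProbIdx m} {w : M.World} {α β τ : Formula m Letter} {s : UnitQ}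

theorem sat_prob : M.Sat w (prob o s β) ↔ ((s : ℚ) : ℝ) ≤ M.pr o w β := by
  cases o <;> exact Iff.rfl

theorem pr_of_forall_sat (h : ∀ w, M.Sat w β) : M.pr o w β = 1 := by
  cases o with
  | run => exact (congrArg _ (Set.eq_univ_of_forall fun r => h (r, 0))).trans (FinAddProb.μ_univ _)
  | agent a =>
    exact (congrArg _ (Set.eq_univ_of_forall fun w' : M.space a w => h w'.1)).trans (FinAddProb.μ_univ _)

theorem pr_of_forall_not_sat (h : ∀ w, ¬ M.Sat w β) : M.pr o w β = 0 := by
  cases o with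
  | run =>
    exact (congrArg _ (Set.eq_empty_of_forall_notMem fun r => h (r, 0))).trans
      (FinAddProb.μ_empty _)
  | agent a =>
    exact (congrArg _ (Set.eq_empty_of_forall_notMem fun w' : M.space a w => h w'.1)).trans
      (FinAddProb.μ_empty _)

/-- Runs are evaluated at time 0, where `●β` holds vacuously. -/
theorem pr_run_prev : M.pr .run w (prev β) = 1 :=
  (congrArg _ (Set.eq_univ_of_forall fun _ => Or.inl rfl)).trans (FinAddProb.μ_univ _)

variable (hM : M.Measurable)
include hM

theorem pr_mem_Icc : M.pr o w β ∈ Set.Icc (0 : ℝ) 1 := by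
  cases o with
  | run => exact (M.runProb w).mem_unit _ (hM w β).1
  | agent a => exact (M.agentProb a w).mem_unit _ ((hM w β).2 a)

theorem pr_or_add_and : M.pr o w (or α β) + M.pr o w (and α β) = M.pr o w α + M.pr o w β := by
  cases o with
  | run =>
    rw [pr, pr, pr, pr, ← (M.runProb w).μ_union_add_inter (hM w α).1 (hM w β).1]
    simp only [(M.isValuation_sat _).or]
    rfl
  | agent a =>
    rw [pr, pr, pr, pr, ← (M.agentProb a w).μ_union_add_inter ((hM w α).2 a) ((hM w β).2 a)]
    simp only [(M.isValuation_sat _).or]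
    rfl

theorem pr_neg : M.pr o w (neg β) = 1 - M.pr o w β := by
  have h₁ := pr_or_add_and hM (o := o) (w := w) (α := β) (β := neg β)
  have h₂ : M.pr o w (or β (neg β)) = 1 := pr_of_forall_sat fun w =>
    ((M.isValuation_sat w).or _ _).2 (em _)
  have h₃ : M.pr o w (and β (neg β)) = 0 := pr_of_forall_not_sat fun w =>
    (M.isValuation_sat w).contra β
  linarith

theorem sat_probLe : M.Sat w (probLe o s β) ↔ M.pr o w β ≤ ((s : ℚ) : ℝ) := by
  rw [probLe, sat_prob, pr_neg hM]
  simp only [UnitQ.compl]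
  push_cast
  exact sub_le_sub_iff_left 1

omit hM in
theorem sat_probLt : M.Sat w (probLt o s β) ↔ M.pr o w β < ((s : ℚ) : ℝ) := by
  rw [probLt, (M.isValuation_sat w).neg, sat_prob, not_le]

omit hM in
theorem sat_iterate_next (r : M.Run) (n l : ℕ) :
    M.Sat (r, n) (next^[l] β) ↔ M.Sat (r, n + l) β := by
  induction l generalizing β with
  | zero => rfl
  | succ l ih => rw [Function.iterate_succ_apply, ih]; rfl

omit hM in
theorem sat_iterate_prev (r : M.Run) {n l : ℕ} (h : l ≤ n) :
    M.Sat (r, n) (prev^[l] β) ↔ M.Sat (r, n - l) β := by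
  induction l generalizing β with
  | zero => rfl
  | succ l ih =>
    rw [Function.iterate_succ_apply, ih (by omega)]
    simp only [Sat, Nat.sub_sub]
    constructor
    · rintro (h' | h')
      · omega
      · exact h'.2
    · exact fun h' => .inr ⟨by omega, h'⟩

theorem sat_of_isAxiom (h : IsAxiom act α) : M.Sat w α := by
  have hv := M.isValuation_sat w
  obtain ⟨r, n⟩ := w
  cases h with
  | taut _ h => exact h _ hv.neg hv.and
  | next_neg α => exact (hv.iff _ _).2 Iff.rfl
  | next_imp α β =>
    simp only [hv.imp, Sat, (M.isValuation_sat _).imp]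
    exact id
  | til_next α β =>
    simp only [hv.iff, hv.or, Sat]
    constructor
    · rintro ⟨j, hj, hβ, hα⟩
      rcases hj.eq_or_lt with rfl | hlt
      · exact .inl hβ
      · exact .inr ⟨hα n le_rfl hlt, j, hlt, hβ, fun k hk => hα k (by omega)⟩
    · rintro (h | ⟨hα, j, hj, hβ, h⟩)
      · exact ⟨n, le_rfl, h, fun k _ _ => by omega⟩
      · refine ⟨j, by omega, hβ, fun k hk hk' => ?_⟩
        rcases hk.eq_or_lt with rfl | hlt
        · exact hα
        · exact h k hlt hk'
  | til_sometime α β =>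
    refine (hv.imp _ _).2 ?_
    rintro ⟨j, hj, hβ, -⟩
    exact ⟨j, hj, hβ, fun _ _ _ => ((M.isValuation_sat _).imp _ _).2 id⟩
  | prev_neg α =>
    simp only [hv.imp, Sat]
    rcases n with _ | n <;> simp
  | prev_imp α β =>
    simp only [hv.imp, Sat, (M.isValuation_sat _).imp]
    rcases n with _ | n <;> simp
  | prev_and α β =>
    simp only [hv.imp, Sat]
    rcases n with _ | n <;> simp
  | next_prev α =>
    simp [hv.iff, Sat]
  | next_prev_comm₁ α =>
    simp only [hv.imp, Sat]
    rcases n with _ | n <;> simp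
  | next_prev_comm₂ α γ =>
    simp only [hv.imp, hv.iff, Sat, contra]
    rcases n with _ | n <;> simp
  | since_prev α β =>
    simp only [hv.iff, hv.or, Sat, contra]
    constructor
    · rintro ⟨j, hj, hβ, hα⟩
      rcases hj.eq_or_lt with rfl | hlt
      · exact .inl hβ
      · exact .inr ⟨by simp; omega, hα n hlt le_rfl,
          .inr ⟨by omega, j, by omega, hβ, fun k hk hk' => hα k hk (by omega)⟩⟩
    · rintro (h | ⟨h0, hα, h⟩)
      · exact ⟨n, le_rfl, h, fun k _ _ => by omega⟩
      · obtain ⟨h1, j, hj, hβ, h⟩ := h.resolve_left fun h => h0 (.inl h)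
        refine ⟨j, by omega, hβ, fun k hk hk' => ?_⟩
        rcases hk'.eq_or_lt with rfl | hlt
        · exact hα
        · exact h k hk (by omega)
  | once_prev β =>
    exact ⟨0, by simp, .inl rfl, fun _ _ _ => ((M.isValuation_sat _).imp _ _).2 id⟩
  | know_imp a α β =>
    simp only [hv.imp, Sat, (M.isValuation_sat _).imp]
    exact fun h₁ h₂ w' hw => h₁ w' hw (h₂ w' hw)
  | know_refl a α =>
    simp only [hv.imp]
    exact fun h h' => h' _ (M.acc_refl a _ ((M.mem_active a r n).2 h))
  | know_aware a =>
    refine (hv.imp _ _).2 fun _ w' hw => (M.mem_active a w'.1 w'.2).1 ?_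
    -- By symmetry `w'` has a successor, so the agent is active there.
    by_contra hne
    exact (M.acc_dead a w').1 hne _ (M.acc_symm _ _ _ hw)
  | know_dead a α =>
    refine (hv.imp _ _).2 fun h w' hw => ?_
    exact absurd hw ((M.acc_dead a _).1 (fun h' => h ((M.mem_active a r n).1 h')) w')
  | know_symm a α =>
    exact (hv.imp _ _).2 fun h w' hw h' => h (h' _ (M.acc_symm _ _ _ hw))
  | know_trans a α =>
    exact (hv.imp _ _).2 fun h w' hw w'' hw' => h w'' (M.acc_trans _ _ _ _ hw hw')
  | common_everyone α k =>
    exact (hv.imp _ _).2 fun h => (M.sat_common _ _).1 h k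
  | prob_zero o α z hz =>
    rw [sat_prob, hz, Rat.cast_zero]
    exact (pr_mem_Icc hM).1
  | prob_le_lt o α s t hst =>
    rw [hv.imp, sat_probLe hM, sat_probLt]
    exact fun h => h.trans_lt (by exact_mod_cast hst)
  | prob_lt_le o α t =>
    rw [hv.imp, sat_probLe hM, sat_probLt]
    exact le_of_lt
  | prob_add o α β s t one u hone hu =>
    rw [hv.imp, hv.and, hv.and, sat_prob, sat_prob, sat_prob, sat_prob, pr_neg hM, hone, hu]
    -- `h₃` forces the conjunction to have probability 0, so the disjunction has the sum of the two
    -- probabilities.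
    rintro ⟨⟨h₁, h₂⟩, h₃⟩
    have h := pr_or_add_and hM (o := o) (w := (r, n)) (α := α) (β := β)
    push_cast at h₃ ⊢
    exact (min_le_right _ _).trans (by linarith)
  | prob_subadd o α β s t u hu =>
    rw [hv.imp, hv.and, sat_probLe hM, sat_probLt, sat_probLt, hu]
    rintro ⟨h₁, h₂⟩
    have h := pr_or_add_and hM (o := o) (w := (r, n)) (α := α) (β := β)
    have h₃ := (pr_mem_Icc hM (o := o) (w := (r, n)) (β := and α β)).1
    push_cast
    linarith
  | prob_start α one hone =>
    rw [sat_prob, hone, pr_run_prev, Rat.cast_one]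

omit hM in
theorem sat_of_infRule {S : Set (Formula m Letter)} (h : InfRule S τ)
    (hS : ∀ σ ∈ S, M.Sat w σ) : M.Sat w τ := by
  have hv := M.isValuation_sat w
  obtain ⟨r, n⟩ := w
  cases h with
  | til α β =>
    rintro ⟨j, hj, hβ, hα⟩
    obtain ⟨i, rfl⟩ := Nat.exists_eq_add_of_le hj
    refine hS _ ⟨i, rfl⟩ ((hv.tilStep _ _ _).2 ⟨fun l hl => ?_, (sat_iterate_next r n i).2 hβ⟩)
    exact (sat_iterate_next r n l).2 (hα _ (by simp) (by simp [hl]))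
  | since α β =>
    rintro ⟨j, hj, hβ, hα⟩
    simp only at hj hβ hα
    refine hS _ ⟨n - j, rfl⟩ ((hv.sinceStep _ _ _).2 ⟨fun l hl => ?_, fun l hl => ?_, ?_⟩)
    · exact (sat_iterate_prev r (by omega)).2 (hα _ (by omega) (by omega))
    · rw [sat_iterate_prev r (by omega)]
      exact (M.isValuation_sat _).contra α
    · rw [sat_iterate_prev r (by omega), Nat.sub_sub_self hj]
      exact hβ
  | common α => exact (M.sat_common _ _).2 fun k => hS _ ⟨k, rfl⟩
  | archimedean o α s hs =>
    rw [sat_prob]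
    by_contra! hlt
    -- The first bound makes `s - 1/i` an admissible index; the second puts it above the actual
    -- probability.
    obtain ⟨i, hi⟩ := exists_nat_gt (max (1 / (s : ℝ)) (1 / ((s : ℝ) - M.pr o (r, n) α)))
    have hi₁ : 1 / (s : ℝ) < i := (le_max_left _ _).trans_lt hi
    have hi₂ := (le_max_right _ _).trans_lt hi
    have hs' : (0 : ℝ) < s := by exact_mod_cast hs
    have hi₀ : (0 : ℝ) < i := (one_div_pos.2 hs').trans hi₁
    have hle : 1 / (s : ℚ) ≤ i := by exact_mod_cast hi₁.le
    have h₀ : (0 : ℚ) ≤ s - 1 / i :=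
      sub_nonneg.2 ((one_div_le hs (by exact_mod_cast hi₀)).1 hle)
    have h₁ : (s : ℚ) - 1 / i ≤ 1 :=
      (sub_le_self _ (one_div_nonneg.2 (by exact_mod_cast hi₀.le))).trans s.2.2
    have := sat_prob.1 (hS _ ⟨i, ⟨_, h₀, h₁⟩, hle, rfl, rfl⟩)
    rw [one_div_lt (sub_pos.2 hlt) hi₀] at hi₂
    push_cast at this
    linarith

omit hM in
-- Truth of `X.app` at a world means truth at all worlds of a set not depending on the formula
-- (empty for `●` at time 0), so validity at each world lifts through every layer.
theorem sat_nested_of_forall {S : Set (Formula m Letter)}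
    (h : ∀ w : M.World, (∀ σ ∈ S, M.Sat w σ) → M.Sat w τ) (β₀ : Formula m Letter)
    (L : List (Formula m Letter × Op m)) (hS : ∀ σ ∈ S, M.Sat w (nested β₀ L σ)) :
    M.Sat w (nested β₀ L τ) := by
  induction L generalizing w with
  | nil =>
    simp only [nested, (M.isValuation_sat w).imp] at hS ⊢
    exact fun hβ => h w fun σ hσ => hS σ hσ hβ
  | cons p L ih =>
    obtain ⟨β, X⟩ := p
    simp only [nested, (M.isValuation_sat w).imp] at hS ⊢
    intro hβ
    cases X with
    | know a => exact fun w' hw => ih fun σ hσ => hS σ hσ hβ w' hw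
    | next => exact ih fun σ hσ => hS σ hσ hβ
    | prev =>
      by_cases h0 : w.2 = 0
      · exact .inl h0
      · exact .inr ⟨by omega, ih fun σ hσ => ((hS σ hσ hβ).resolve_left h0).2⟩

theorem sat_of_thm (h : Thm act α) (w : M.World) : M.Sat w α := by
  induction h generalizing w with
  | ax h => exact sat_of_isAxiom hM h
  | @rule Γ φ h _ ih =>
    rcases h.mp_or_infRule with ⟨α, rfl⟩ | ⟨β₀, L, S, τ, hi, rfl, rfl⟩
    · exact ((M.isValuation_sat w).imp _ _).1 (ih _ (.inr rfl) w) (ih _ (.inl rfl) w)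
    · exact sat_nested_of_forall (fun _ => sat_of_infRule hi) β₀ L fun σ hσ => ih _ ⟨σ, hσ, rfl⟩ w
  | nec h _ ih =>
    cases h with
    | next α => exact ih α rfl _
    | prev α => exact or_iff_not_imp_left.2 fun h => ⟨Nat.pos_of_ne_zero h, ih α rfl _⟩
    | know a α => exact fun w' _ => ih α rfl w'
    | prob o α one hone => rw [sat_prob, hone, pr_of_forall_sat (ih α rfl), Rat.cast_one]

theorem sat_of_der {T : Set (Formula m Letter)} (hT : ∀ τ ∈ T, M.Sat w τ) (h : Der act T α) :
    M.Sat w α := by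
  refine Der.induct (P := M.Sat w) (fun α h => sat_of_thm hM h w) hT ?_ ?_ h
  · exact fun α β h₁ h₂ => ((M.isValuation_sat w).imp _ _).1 h₂ h₁
  · exact fun β₀ L S τ h => sat_nested_of_forall (fun _ => sat_of_infRule h) β₀ L

end Model

end Soundness

end PTEL

theorem theorem9 {m : ℕ} {Letter : Type*} [Nonempty Letter] [Countable Letter]
    (act : Fin m → Letter) (T : Set (PTEL.Formula m Letter)) :
    PTEL.Consistent act T ↔ PTEL.Satisfiable act T := by
  constructor
  · intro h
    obtain ⟨α, hα⟩ := not_forall.1 h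
    exact PTEL.Con.satisfiable ⟨α, fun h => hα h.derivable⟩
  · rintro ⟨M, hM, w, hw⟩ h
    have p : Letter := Classical.arbitrary Letter
    exact (M.isValuation_sat w).contra (.letter p)
      (PTEL.Model.sat_of_der hM hw (h (.contra (.letter p))).der)
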